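/- Let $\alpha,\beta>0$, $n\ge 0$ an integer, $u_0\in L^2(\mathbb R^n)$, and let $u\in C([0,\infty);L^2(\mathbb R^n))$ be the solution of the free Schrödinger equation $$\partial_t u=i\Delta u\quad (t>0,\ x\in\mathbb R^n),\qquad u(\cdot,0)=u_0,$$ the equation being understood in the sense of tempered distributions. Write $\widehat f(\xi)=(2\pi)^{-n/2}\int_{\mathbb R^n}e^{-ix\cdot\xi}f(x)\,dx$ for the (unitary) Fourier transform on $L^2(\mathbb R^n)$, $\|\cdot\|_2$ for the $L^2(\mathbb R^n)$ norm (equal to $+\infty$ if the function is not square integrable), and, for $T>0$ and $t\ge 0$, $$\theta(t)=\frac{\beta(T-t)}{T(\alpha t+\beta)},\qquad \mu(t)=\frac{\beta}{\alpha t+\beta}.$$ Then for every $\lambda\in\mathbb R^n$ and $T>0$ each of the following estimates holds; in particular its left-hand side is finite whenever its right-hand side is (in $[0,\infty]$ with $\infty^0=1$ and $0\cdot\infty=0$): $$\|e^{\frac{\lambda\cdot x}{\alpha t+\beta}}u(t)\|_2\le \|e^{\frac{\lambda\cdot x}{\beta}}u_0\|_2^{\theta(t)}\,\|e^{\frac{\lambda\cdot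 x}{\alpha T+\beta}}u(T)\|_2^{1-\theta(t)},\qquad 0\le t\le T,$$ $$\|e^{\frac{\lambda\cdot x}{\alpha t+\beta}}u(t)\|_2\le \|e^{\frac{\lambda\cdot x}{\beta}}u_0\|_2^{\mu(t)}\,\|e^{\frac{2\lambda\cdot \xi}{\alpha}}\widehat{u_0}\|_2^{1-\mu(t)},\qquad t\ge 0,$$ $$\|e^{\frac{|x|^2}{(\alpha t+\beta)^2}}u(t)\|_2\le \|e^{\frac{|x|^2}{\beta^2}}u_0\|_2^{\theta(t)}\,\|e^{\frac{|x|^2}{(\alpha T+\beta)^2}}u(T)\|_2^{1-\theta(t)},\qquad 0\le t\le T,$$ $$\|e^{\frac{|x|^2}{(\alpha t+\beta)^2}}u(t)\|_2\le \|e^{\frac{|x|^2}{\beta^2}}u_0\|_2^{\mu(t)}\,\|e^{\frac{4|\xi|^2}{\alpha^2}}\widehat{u_0}\|_2^{1-\mu(t)},\qquad t\ge 0.$$ -/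

import Mathlib

open MeasureTheory Set
open scoped ENNReal SchwartzMap FourierTransform Laplacian

noncomputable section

/-- Complex-valued `L²` functions on `ℝⁿ` with Lebesgue measure. -/
abbrev L2Space (n : ℕ) : Type :=
  Lp ℂ 2 (volume : Measure (EuclideanSpace ℝ (Fin n)))

/-- `u` is the solution of `∂ₜ u = i Δ u` for `t > 0`, `u(0) = u₀`, with `u` a continuous curve in
`L²(ℝⁿ)` on `[0, ∞)`. The equation is understood in the sense of tempered distributions:
`d/dt ⟨u(t), φ⟩ = ⟨i Δ u(t), φ⟩` for every Schwartz function `φ` and every `t > 0`. -/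
structure IsFreeSchrodingerSolution {n : ℕ} (u₀ : L2Space n) (u : ℝ → L2Space n) : Prop where
  continuousOn : ContinuousOn u (Ici 0)
  initial : u 0 = u₀
  equation : ∀ t : ℝ, 0 < t → ∀ φ : 𝓢(EuclideanSpace ℝ (Fin n), ℂ),
    HasDerivAt (fun s : ℝ => (u s : 𝓢'(EuclideanSpace ℝ (Fin n), ℂ)) φ)
      ((Complex.I • Δ (u t : 𝓢'(EuclideanSpace ℝ (Fin n), ℂ))) φ) t

/-- The unitary Fourier transform on `L²(ℝⁿ)` with angular frequency, that is, the extension to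
`L²` of `f ↦ (2π)^(-n/2) ∫ exp(-i x·ξ) f(x) dx`. Mathlib's `𝓕` is the extension of
`f ↦ ∫ exp(-2πi x·ξ) f(x) dx`. -/
def angularFourier {n : ℕ} (f : L2Space n) (ξ : EuclideanSpace ℝ (Fin n)) : ℂ :=
  (((2 * Real.pi) ^ (-(n : ℝ) / 2) : ℝ) : ℂ) *
    (𝓕 f : L2Space n) ((2 * Real.pi)⁻¹ • ξ)

/-- The weighted norm `‖e^w f‖₂`, with value `∞` when `e^w f` is not square integrable. -/
def expWeightedNorm {n : ℕ} (w : EuclideanSpace ℝ (Fin n) → ℝ)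
    (f : EuclideanSpace ℝ (Fin n) → ℂ) : ℝ≥0∞ :=
  eLpNorm (fun x => (Real.exp (w x) : ℂ) * f x) 2 volume

/-- `θ(t) = β (T - t) / (T (α t + β))`. -/
def thetaExponent (α β T t : ℝ) : ℝ := β * (T - t) / (T * (α * t + β))

/-- `μ(t) = β / (α t + β)`. -/
def muExponent (α β t : ℝ) : ℝ := β / (α * t + β)

end

/-! Write `p = -i∇`. In the Heisenberg picture, multiplication by `exp (s λ·x)` at time `t` is `exp
(s λ·(x + 2tp))` acting on `u₀`, so every linear weighted norm is `‖exp (a λ·x + c λ·p) u₀‖` at some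
point `(a, c)` of the plane. For `s = 1/(αt + β)` the points `(s, 2ts)` all lie on the line `βa +
(α/2)c = 1`: time `0` gives `(1/β, 0)`, and `t → ∞` gives `(0, 2/α)`, a weight in `p` alone, hence a
weight on the Fourier transform of `u₀`. The linear estimates are thus log-convexity of the norm in
`(a, c)`, with `θ` and `μ` as barycentric coordinates. Log-convexity is a three lines argument: an
imaginary displacement of `(a, c)` composes with a unitary Weyl operator, up to a scalar exponential
from the commutator of `x` and `p`, which an explicit factor cancels.

The operators being unbounded, they are transposed onto linear combinations of Gaussians `exp
(-K|ξ|² + w·ξ)` on the Fourier side. For fixed `K` this family is invariant under all complex Weyl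
operators, and its pairings with an `L²` function are entire of order at most two along complex
lines in `(a, c)`. Weighted norms become instances of `WeylBound`, which are interpolated by
`WeylBound.interp`; `weylBound_evolution_iff` passes between times by changing the imaginary part of
`K`; `eLpNorm_weight_le_of_weylBound` recovers the norm by duality, and with it the finiteness of
the left-hand side. That a distributional solution is given by the expected Fourier multiplier is
`IsFreeSchrodingerSolution.fourier_ae_eq`.

For quadratic weights, the squared linear estimate is integrated over `λ` against a Gaussian: the
linear exponentials superpose to a quadratic one, and Hölder's inequality keeps the exponents
(`expWeightedNorm_quadratic_of_linear`). -/

noncomputable section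

/-! ### Complex Gaussians and their Fourier transforms -/

/-- The bilinear pairing of a complex covector with a real vector. -/
def cdot {n : ℕ} (w : Fin n → ℂ) (x : EuclideanSpace ℝ (Fin n)) : ℂ := ∑ i, w i * (x i : ℂ)

/-- The Gaussian `x ↦ exp (-K |x|² + w · x)` with complex parameters. -/
def gauss {n : ℕ} (K : ℂ) (w : Fin n → ℂ) (x : EuclideanSpace ℝ (Fin n)) : ℂ :=
  Complex.exp (-K * (‖x‖ : ℂ) ^ 2 + cdot w x)

/-- A real vector as a complex covector. -/
def toC {n : ℕ} (v : EuclideanSpace ℝ (Fin n)) : Fin n → ℂ := fun i => (v i : ℂ)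

section Gauss

variable {n : ℕ}

local notation "ℝⁿ" => EuclideanSpace ℝ (Fin n)

lemma norm_sq_eq_sum (x : ℝⁿ) : ((‖x‖ : ℂ)) ^ 2 = ∑ i, (x i : ℂ) ^ 2 := by
  have := EuclideanSpace.norm_sq_eq x
  simp only [Real.norm_eq_abs, sq_abs] at this
  exact_mod_cast this

lemma inner_eq_cdot (v x : ℝⁿ) : ((inner ℝ v x : ℝ) : ℂ) = cdot (toC v) x := by
  simp [cdot, toC, PiLp.inner_apply, mul_comm]

lemma cdot_add_left (w w' : Fin n → ℂ) (x : ℝⁿ) : cdot (w + w') x = cdot w x + cdot w' x := by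
  simp [cdot, add_mul, Finset.sum_add_distrib]

lemma cdot_smul_left (c : ℂ) (w : Fin n → ℂ) (x : ℝⁿ) : cdot (c • w) x = c * cdot w x := by
  simp [cdot, Finset.mul_sum, mul_assoc]

lemma cdot_add_right (w : Fin n → ℂ) (x y : ℝⁿ) : cdot w (x + y) = cdot w x + cdot w y := by
  simp [cdot, mul_add, Finset.sum_add_distrib]

lemma cdot_smul_right (w : Fin n → ℂ) (r : ℝ) (x : ℝⁿ) : cdot w (r • x) = r * cdot w x := by
  simp only [cdot, Finset.mul_sum, PiLp.smul_apply, smul_eq_mul, Complex.ofReal_mul]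
  exact Finset.sum_congr rfl fun i _ => by ring

@[fun_prop]
lemma continuous_cdot (w : Fin n → ℂ) : Continuous (cdot w : ℝⁿ → ℂ) := by
  unfold cdot; fun_prop

@[fun_prop]
lemma continuous_gauss (K : ℂ) (w : Fin n → ℂ) : Continuous (gauss K w : ℝⁿ → ℂ) := by
  unfold gauss; fun_prop

lemma norm_gauss (K : ℂ) (w : Fin n → ℂ) (x : ℝⁿ) :
    ‖gauss K w x‖ = Real.exp (-K.re * ‖x‖ ^ 2 + (cdot w x).re) := by
  rw [gauss, Complex.norm_exp]
  congr 1
  simp only [← Complex.ofReal_pow, Complex.add_re, Complex.mul_re, Complex.neg_re,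
    Complex.ofReal_re, Complex.ofReal_im, mul_zero, sub_zero]

lemma integrable_gauss {K : ℂ} (hK : 0 < K.re) (w : Fin n → ℂ) :
    Integrable (gauss K w : ℝⁿ → ℂ) := by
  rw [← (PiLp.volume_preserving_toLp (Fin n)).integrable_comp_emb
    (MeasurableEquiv.toLp 2 _).measurableEmbedding]
  convert! GaussianFourier.integrable_cexp_neg_mul_sum_add hK w using 2 with v
  simp [gauss, cdot, norm_sq_eq_sum]

lemma integral_gauss {K : ℂ} (hK : 0 < K.re) (w : Fin n → ℂ) :
    ∫ x : ℝⁿ, gauss K w x =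
      (Real.pi / K) ^ (n / 2 : ℂ) * Complex.exp ((∑ i, w i ^ 2) / (4 * K)) := by
  rw [← (PiLp.volume_preserving_toLp (Fin n)).integral_comp
    (MeasurableEquiv.toLp 2 _).measurableEmbedding]
  have := GaussianFourier.integral_cexp_neg_mul_sum_add hK w
  rw [Fintype.card_fin] at this
  rw [← this]
  refine integral_congr_ae (Filter.Eventually.of_forall fun v => ?_)
  simp [gauss, cdot, norm_sq_eq_sum]

lemma memLp_gauss {K : ℂ} (hK : 0 < K.re) (w : Fin n → ℂ) :
    MemLp (gauss K w : ℝⁿ → ℂ) 2 volume := by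
  rw [memLp_two_iff_integrable_sq_norm (by fun_prop)]
  have h := (integrable_gauss (K := 2 * K) (by simpa using hK) ((2 : ℂ) • w)).norm
  refine h.congr (Filter.Eventually.of_forall fun x => ?_)
  simp only [norm_gauss, cdot_smul_left, ← Real.exp_nat_mul]
  congr 1
  simp
  ring

/-- The Fourier character is absorbed in the complex linear coefficient, which reduces the transform
to a Gaussian integral. -/
lemma fourier_gauss {K : ℂ} (hK : 0 < K.re) (w : Fin n → ℂ) (x : ℝⁿ) :
    𝓕 (gauss K w : ℝⁿ → ℂ) x = (Real.pi / K) ^ (n / 2 : ℂ) *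
      Complex.exp ((∑ i, (w i - 2 * Real.pi * Complex.I * x i) ^ 2) / (4 * K)) := by
  rw [Real.fourier_eq', ← integral_gauss hK]
  refine integral_congr_ae (Filter.Eventually.of_forall fun v => ?_)
  simp only [gauss, smul_eq_mul, ← Complex.exp_add]
  congr 1
  have : cdot (fun i => w i - 2 * Real.pi * Complex.I * x i) v =
      cdot w v - 2 * Real.pi * Complex.I * ((inner ℝ v x : ℝ) : ℂ) := by
    rw [inner_eq_cdot]
    simp only [cdot, toC, sub_mul, Finset.sum_sub_distrib, Finset.mul_sum]
    congr 1
    exact Finset.sum_congr rfl fun i _ => by ring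
  rw [this]
  push_cast
  ring

lemma re_pos_pi_sq_div {K : ℂ} (hK : 0 < K.re) : 0 < ((Real.pi : ℂ) ^ 2 / K).re := by
  have h0 : K ≠ 0 := fun h => by simp [h] at hK
  rw [div_eq_mul_inv, ← Complex.ofReal_pow, Complex.re_ofReal_mul, Complex.inv_re]
  have := Complex.normSq_pos.2 h0
  positivity

lemma fourier_gauss_eq_gauss {K : ℂ} (hK : 0 < K.re) (w : Fin n → ℂ) :
    𝓕 (gauss K w : ℝⁿ → ℂ) = fun x => (Real.pi / K) ^ (n / 2 : ℂ) *
      Complex.exp ((∑ i, w i ^ 2) / (4 * K)) *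
        gauss (Real.pi ^ 2 / K) ((-(Real.pi * Complex.I / K)) • w) x := by
  have h0 : K ≠ 0 := fun h => by simp [h] at hK
  ext x
  rw [fourier_gauss hK, mul_assoc ((Real.pi / K : ℂ) ^ (n / 2 : ℂ)), gauss, ← Complex.exp_add]
  congr 2
  rw [norm_sq_eq_sum]
  simp only [cdot, Pi.smul_apply, smul_eq_mul, Finset.mul_sum, Finset.sum_div,
    ← Finset.sum_add_distrib]
  refine Finset.sum_congr rfl fun i _ => ?_
  field_simp
  ring_nf
  simp only [Complex.I_sq]
  ring

lemma memLp_fourier_gauss {K : ℂ} (hK : 0 < K.re) (w : Fin n → ℂ) :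
    MemLp (𝓕 (gauss K w : ℝⁿ → ℂ)) 2 volume := by
  rw [fourier_gauss_eq_gauss hK]
  exact (memLp_gauss (re_pos_pi_sq_div hK) _).const_mul _

/-! ### The Fourier transform on `L²` -/

lemma integrable_mul_of_memLp_two {f g : ℝⁿ → ℂ} (hf : MemLp f 2 volume) (hg : MemLp g 2 volume) :
    Integrable (fun x => f x * g x) := hf.integrable_mul hg

/-- The Cauchy–Schwarz inequality for the bilinear pairing. -/
lemma norm_integral_mul_le {f g : ℝⁿ → ℂ} (hf : MemLp f 2 volume) (hg : MemLp g 2 volume) :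
    ‖∫ x, f x * g x‖ ≤ (eLpNorm f 2 volume).toReal * (eLpNorm g 2 volume).toReal := by
  have h1 : ‖∫ x, f x * g x‖ₑ ≤ eLpNorm f 2 volume * eLpNorm g 2 volume := by
    refine (enorm_integral_le_lintegral_enorm _).trans ?_
    rw [← eLpNorm_one_eq_lintegral_enorm]
    have h : eLpNorm (f • g) 1 volume ≤ eLpNorm f 2 volume * eLpNorm g 2 volume :=
      eLpNorm_smul_le_mul_eLpNorm hg.1 hf.1
    exact h
  have h2 := ENNReal.toReal_mono (ENNReal.mul_ne_top hf.2.ne hg.2.ne) h1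
  rwa [ENNReal.toReal_mul, toReal_enorm] at h2

/-- The bilinear pairing on `L²`. -/
def pairing (f g : L2Space n) : ℂ := ∫ x, f x * g x

lemma pairing_eq_lpPairing (f g : L2Space n) :
    pairing f g = (ContinuousLinearMap.mul ℂ ℂ).lpPairing volume 2 2 f g := by
  rw [ContinuousLinearMap.lpPairing_eq_integral]
  rfl

lemma continuous_pairing : Continuous fun p : L2Space n × L2Space n => pairing p.1 p.2 := by
  simp only [pairing_eq_lpPairing]
  exact ((ContinuousLinearMap.mul ℂ ℂ).lpPairing volume 2 2).continuous₂

lemma pairing_toLp (f : L2Space n) (φ : 𝓢(ℝⁿ, ℂ)) :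
    pairing f (φ.toLp 2) = (f : 𝓢'(ℝⁿ, ℂ)) φ := by
  rw [Lp.toTemperedDistribution_apply, pairing]
  refine integral_congr_ae ?_
  filter_upwards [φ.coeFn_toLp 2 volume] with x hx
  rw [hx, smul_eq_mul, mul_comm]

/-- Schwartz functions are dense in `L²`; for Schwartz `g` this is the definition of the Fourier
transform of a tempered distribution. -/
lemma pairing_fourier (f g : L2Space n) : pairing (𝓕 f) g = pairing f (𝓕 g) := by
  have hc : Continuous fun g : L2Space n => (𝓕 g : L2Space n) :=
    (Lp.fourierTransformₗᵢ ℝⁿ ℂ).continuous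
  refine DenseRange.induction_on (p := fun g : L2Space n => pairing (𝓕 f) g = pairing f (𝓕 g))
    (SchwartzMap.denseRange_toLpCLM (p := 2) ENNReal.ofNat_ne_top) g ?_ ?_
  · exact isClosed_eq (continuous_pairing.comp (continuous_const.prodMk continuous_id))
      (continuous_pairing.comp (continuous_const.prodMk hc))
  · intro φ
    rw [SchwartzMap.toLpCLM_apply, SchwartzMap.toLp_fourier_eq, pairing_toLp, pairing_toLp,
      ← Lp.fourier_toTemperedDistribution_eq, TemperedDistribution.fourier_apply]

lemma integral_fourier_mul_schwartz {g : ℝⁿ → ℂ} (hg : Integrable g) (φ : 𝓢(ℝⁿ, ℂ)) :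
    ∫ x, 𝓕 g x * φ x = ∫ x, g x * 𝓕 φ x := by
  simpa using! VectorFourier.integral_fourierIntegral_smul_eq_flip (L := innerₗ ℝⁿ)
    Real.continuous_fourierChar continuous_inner hg φ.integrable

/-- On `L¹ ∩ L²` the `L²` Fourier transform is given by the Fourier integral. -/
lemma fourier_toLp {g : ℝⁿ → ℂ} (h1 : Integrable g) (h2 : MemLp g 2 volume)
    (hF : MemLp (𝓕 g) 2 volume) : 𝓕 (h2.toLp g) = hF.toLp (𝓕 g) := by
  have hinj : Function.Injective (Lp.toTemperedDistributionCLM (E := ℝⁿ) ℂ volume 2) :=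
    LinearMap.ker_eq_bot.1 Lp.ker_toTemperedDistributionCLM_eq_bot
  apply hinj
  ext φ
  simp only [Lp.toTemperedDistributionCLM_apply]
  rw [← Lp.fourier_toTemperedDistribution_eq, TemperedDistribution.fourier_apply,
    Lp.toTemperedDistribution_apply, Lp.toTemperedDistribution_apply]
  trans ∫ x, g x * 𝓕 φ x
  · refine integral_congr_ae ?_
    filter_upwards [h2.coeFn_toLp] with x hx
    rw [hx, smul_eq_mul, mul_comm]
  · rw [← integral_fourier_mul_schwartz h1]
    refine integral_congr_ae ?_
    filter_upwards [hF.coeFn_toLp] with x hx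
    rw [hx, smul_eq_mul, mul_comm]

lemma integral_fourier_mul (f : L2Space n) {g : ℝⁿ → ℂ} (h1 : Integrable g)
    (h2 : MemLp g 2 volume) (hF : MemLp (𝓕 g) 2 volume) :
    ∫ x, (𝓕 f : L2Space n) x * g x = ∫ x, f x * 𝓕 g x := by
  have h := pairing_fourier f (h2.toLp g)
  rw [fourier_toLp h1 h2 hF] at h
  unfold pairing at h
  convert h using 1
  · refine integral_congr_ae ?_
    filter_upwards [h2.coeFn_toLp] with x hx
    rw [hx]
  · refine integral_congr_ae ?_
    filter_upwards [hF.coeFn_toLp] with x hx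
    rw [hx]

lemma eLpNorm_fourier {g : ℝⁿ → ℂ} (h1 : Integrable g) (h2 : MemLp g 2 volume)
    (hF : MemLp (𝓕 g) 2 volume) : eLpNorm (𝓕 g) 2 volume = eLpNorm g 2 volume := by
  have h := Lp.norm_fourier_eq (h2.toLp g)
  rw [fourier_toLp h1 h2 hF, Lp.norm_toLp, Lp.norm_toLp,
    ENNReal.toReal_eq_toReal_iff' hF.2.ne h2.2.ne] at h
  exact h

/-- An integrable function with vanishing Fourier transform vanishes almost everywhere. -/
lemma ae_eq_zero_of_fourier_eq_zero {g : ℝⁿ → ℂ} (hg : Integrable g) (h : ∀ x, 𝓕 g x = 0) :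
    g =ᵐ[volume] 0 := by
  refine ae_eq_zero_of_integral_contDiff_smul_eq_zero hg.locallyIntegrable fun φ hφ hφc => ?_
  have hg₁ : HasCompactSupport (Complex.ofRealCLM ∘ φ) := hφc.comp_left rfl
  have hg₂ : ContDiff ℝ _ (Complex.ofRealCLM ∘ φ) := Complex.ofRealCLM.contDiff.comp hφ
  -- By Fourier inversion `φ` is itself a transform, so its pairing with `g` is a pairing with `𝓕 g
  -- = 0`.
  have h' := integral_fourier_mul_schwartz hg (𝓕⁻ (hg₁.toSchwartzMap hg₂))
  rw [FourierTransform.fourier_fourierInv_eq] at h'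
  simp only [h, zero_mul, integral_zero] at h'
  rw [h']
  refine integral_congr_ae (Filter.Eventually.of_forall fun x => ?_)
  simp [mul_comm]

end Gauss

/-! ### The free evolution on the Fourier side -/

section Propagation

variable {n : ℕ}

local notation "ℝⁿ" => EuclideanSpace ℝ (Fin n)

open Filter Topology

lemma norm_exp_mul_I_sub_one_sub_le (x : ℝ) :
    ‖Complex.exp (x * Complex.I) - 1 - x * Complex.I‖ ≤ 3 * x ^ 2 := by
  rcases le_or_gt |x| 1 with h | h
  · have h' := Complex.norm_exp_sub_one_sub_id_le (x := x * Complex.I) (by simpa using h)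
    simp only [norm_mul, Complex.norm_real, Real.norm_eq_abs, Complex.norm_I, mul_one,
      sq_abs] at h'
    nlinarith [sq_nonneg x]
  · have h1 : ‖Complex.exp (x * Complex.I) - 1 - x * Complex.I‖ ≤ 1 + 1 + |x| := by
      refine (norm_sub_le _ _).trans (add_le_add ((norm_sub_le _ _).trans ?_) ?_)
      · rw [Complex.norm_exp_ofReal_mul_I, norm_one]
      · simp
    have h2 : x ^ 2 = |x| ^ 2 := (sq_abs x).symm
    nlinarith

lemma norm_phase_taylor_le (r s q : ℝ) (c : ℂ) :
    ‖Complex.exp (((r * q : ℝ) : ℂ) * Complex.I) * c -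
        Complex.exp (((s * q : ℝ) : ℂ) * Complex.I) * c -
        (r - s) • ((q : ℂ) * Complex.I * Complex.exp (((s * q : ℝ) : ℂ) * Complex.I) * c)‖ ≤
      (r - s) ^ 2 * (3 * q ^ 2) * ‖c‖ := by
  have e : Complex.exp (((r * q : ℝ) : ℂ) * Complex.I) * c -
      Complex.exp (((s * q : ℝ) : ℂ) * Complex.I) * c -
      (r - s) • ((q : ℂ) * Complex.I * Complex.exp (((s * q : ℝ) : ℂ) * Complex.I) * c) =
      (Complex.exp ((((r - s) * q : ℝ) : ℂ) * Complex.I) - 1 -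
        (((r - s) * q : ℝ) : ℂ) * Complex.I) *
        (Complex.exp (((s * q : ℝ) : ℂ) * Complex.I) * c) := by
    have : Complex.exp (((r * q : ℝ) : ℂ) * Complex.I) =
        Complex.exp ((((r - s) * q : ℝ) : ℂ) * Complex.I) *
          Complex.exp (((s * q : ℝ) : ℂ) * Complex.I) := by
      rw [← Complex.exp_add]; congr 1; push_cast; ring
    rw [this, Complex.real_smul]
    push_cast
    ring
  rw [e, norm_mul, norm_mul, Complex.norm_exp_ofReal_mul_I, one_mul]
  refine mul_le_mul_of_nonneg_right ((norm_exp_mul_I_sub_one_sub_le _).trans (le_of_eq ?_))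
    (norm_nonneg _)
  ring

/-- The symbol of the free evolution, up to the factor `-i`. -/
def symbolSq (ξ : ℝⁿ) : ℝ := 4 * Real.pi ^ 2 * ‖ξ‖ ^ 2

lemma contDiff_symbolSq : ContDiff ℝ ((⊤ : ℕ∞) : WithTop ℕ∞) (symbolSq : ℝⁿ → ℝ) := by
  unfold symbolSq
  exact contDiff_const.mul (contDiff_norm_sq ℝ)

/-- The product of a smooth function with a smooth function of compact support. -/
def mulSchwartz (φ m : ℝⁿ → ℂ) (hφ : ContDiff ℝ ((⊤ : ℕ∞) : WithTop ℕ∞) φ)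
    (hc : HasCompactSupport φ) (hm : ContDiff ℝ ((⊤ : ℕ∞) : WithTop ℕ∞) m) : 𝓢(ℝⁿ, ℂ) :=
  HasCompactSupport.toSchwartzMap (f := fun x => m x * φ x) hc.mul_left (hm.mul hφ)

@[simp]
lemma mulSchwartz_apply (φ m : ℝⁿ → ℂ) (hφ : ContDiff ℝ ((⊤ : ℕ∞) : WithTop ℕ∞) φ)
    (hc : HasCompactSupport φ) (hm : ContDiff ℝ ((⊤ : ℕ∞) : WithTop ℕ∞) m) (x : ℝⁿ) :
    mulSchwartz φ m hφ hc hm x = m x * φ x := rfl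

lemma contDiff_phase (s : ℝ) : ContDiff ℝ ((⊤ : ℕ∞) : WithTop ℕ∞)
    (fun ξ : ℝⁿ => Complex.exp (((s * symbolSq ξ : ℝ) : ℂ) * Complex.I)) := by
  refine ContDiff.cexp (ContDiff.mul ?_ contDiff_const)
  exact Complex.ofRealCLM.contDiff.comp (contDiff_const.mul contDiff_symbolSq)

lemma contDiff_symbol_mul_phase (s : ℝ) : ContDiff ℝ ((⊤ : ℕ∞) : WithTop ℕ∞)
    (fun ξ : ℝⁿ => (symbolSq ξ : ℂ) * Complex.I *
      Complex.exp (((s * symbolSq ξ : ℝ) : ℂ) * Complex.I)) :=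
  ((Complex.ofRealCLM.contDiff.comp contDiff_symbolSq).mul contDiff_const).mul (contDiff_phase s)

lemma contDiff_symbolSq_sq : ContDiff ℝ ((⊤ : ℕ∞) : WithTop ℕ∞)
    (fun ξ : ℝⁿ => (3 * (symbolSq ξ : ℂ) ^ 2)) :=
  contDiff_const.mul ((Complex.ofRealCLM.contDiff.comp contDiff_symbolSq).pow 2)

variable {φ : EuclideanSpace ℝ (Fin n) → ℂ} (hφ : ContDiff ℝ ((⊤ : ℕ∞) : WithTop ℕ∞) φ)
  (hc : HasCompactSupport φ)

/-- The pointwise Taylor remainder is at most `(r - s)²` times a fixed multiple of `φ`; compact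
support puts that multiple in `L²`, so the pointwise derivative is a derivative in norm. -/
lemma hasDerivAt_phase_toLp (s : ℝ) :
    HasDerivAt (fun r => (mulSchwartz φ _ hφ hc (contDiff_phase r)).toLp 2 volume)
      ((mulSchwartz φ _ hφ hc (contDiff_symbol_mul_phase s)).toLp 2 volume) s := by
  rw [hasDerivAt_iff_tendsto]
  set C := ‖(mulSchwartz φ _ hφ hc contDiff_symbolSq_sq).toLp 2 volume‖ with hC
  have key : ∀ r : ℝ, ‖(mulSchwartz φ _ hφ hc (contDiff_phase r)).toLp 2 volume -
      (mulSchwartz φ _ hφ hc (contDiff_phase s)).toLp 2 volume -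
      (r - s) • (mulSchwartz φ _ hφ hc (contDiff_symbol_mul_phase s)).toLp 2 volume‖ ≤
      ‖r - s‖ ^ 2 * C := by
    intro r
    have : ‖r - s‖ ^ 2 * C =
        ‖((r - s) ^ 2) • (mulSchwartz φ _ hφ hc contDiff_symbolSq_sq).toLp 2 volume‖ := by
      rw [norm_smul, hC]; simp
    rw [this]
    refine Lp.norm_le_norm_of_ae_le ?_
    filter_upwards [Lp.coeFn_sub ((mulSchwartz φ _ hφ hc (contDiff_phase r)).toLp 2 volume -
      (mulSchwartz φ _ hφ hc (contDiff_phase s)).toLp 2 volume)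
      ((r - s) • (mulSchwartz φ _ hφ hc (contDiff_symbol_mul_phase s)).toLp 2 volume),
      Lp.coeFn_sub ((mulSchwartz φ _ hφ hc (contDiff_phase r)).toLp 2 volume)
      ((mulSchwartz φ _ hφ hc (contDiff_phase s)).toLp 2 volume),
      Lp.coeFn_smul (r - s) ((mulSchwartz φ _ hφ hc (contDiff_symbol_mul_phase s)).toLp 2 volume),
      Lp.coeFn_smul ((r - s) ^ 2) ((mulSchwartz φ _ hφ hc contDiff_symbolSq_sq).toLp 2 volume),
      SchwartzMap.coeFn_toLp (mulSchwartz φ _ hφ hc (contDiff_phase r)) 2 volume,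
      SchwartzMap.coeFn_toLp (mulSchwartz φ _ hφ hc (contDiff_phase s)) 2 volume,
      SchwartzMap.coeFn_toLp (mulSchwartz φ _ hφ hc (contDiff_symbol_mul_phase s)) 2 volume,
      SchwartzMap.coeFn_toLp (mulSchwartz φ _ hφ hc contDiff_symbolSq_sq) 2 volume]
      with x h1 h2 h3 h4 h5 h6 h7 h8
    rw [h1, Pi.sub_apply, h2, Pi.sub_apply, h3, Pi.smul_apply, h4, Pi.smul_apply, h5, h6, h7, h8]
    simp only [mulSchwartz_apply]
    rw [norm_smul, Real.norm_of_nonneg (sq_nonneg _)]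
    have h := norm_phase_taylor_le r s (symbolSq x) (φ x)
    rw [norm_mul, norm_mul, norm_pow, Complex.norm_real, Complex.norm_ofNat, Real.norm_eq_abs,
      sq_abs]
    refine h.trans (le_of_eq ?_)
    ring
  refine squeeze_zero (g := fun r => ‖r - s‖ * C) (fun r => by positivity) (fun r => ?_) ?_
  · rcases eq_or_ne r s with rfl | hne
    · simp
    · have hpos : 0 < ‖r - s‖ := norm_pos_iff.2 (sub_ne_zero.2 hne)
      rw [inv_mul_le_iff₀ hpos]
      refine (key r).trans (le_of_eq (by ring))
  · have : Continuous fun r : ℝ => ‖r - s‖ * C := by fun_prop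
    simpa using this.tendsto s

lemma continuousOn_pairing {v p : ℝ → L2Space n} {S : Set ℝ} (hv : ContinuousOn v S)
    (hp : ContinuousOn p S) : ContinuousOn (fun r => pairing (v r) (p r)) S :=
  continuous_pairing.comp_continuousOn (hv.prodMk hp)

/-- A product rule: one factor is weakly differentiable and strongly continuous, the other one is
strongly differentiable. -/
lemma hasDerivAt_pairing {v p : ℝ → L2Space n} {p' : L2Space n} {d : ℂ} {s : ℝ}
    (hv : ContinuousAt v s) (hp : HasDerivAt p p' s)
    (h : HasDerivAt (fun r => pairing (v r) (p s)) d s) :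
    HasDerivAt (fun r => pairing (v r) (p r)) (d + pairing (v s) p') s := by
  -- The difference quotients of `p` converge in `L²`, so pairing them with `v r` requires only the
  -- continuity of `v`.
  have h2 : HasDerivAt (fun r => pairing (v r) (p r - p s)) (pairing (v s) p') s := by
    rw [hasDerivAt_iff_tendsto_slope] at hp ⊢
    have h4 : Tendsto v (𝓝[≠] s) (𝓝 (v s)) := hv.tendsto.mono_left nhdsWithin_le_nhds
    refine ((continuous_pairing.tendsto (v s, p')).comp (h4.prodMk_nhds hp)).congr fun r => ?_
    simp only [Function.comp, slope, vsub_eq_sub, sub_self, pairing_eq_lpPairing, map_zero,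
      sub_zero]
    exact ContinuousLinearMap.map_smul_of_tower _ _ _
  refine (h.add h2).congr_of_eventuallyEq (Eventually.of_forall fun r => ?_)
  simp only [Pi.add_apply, pairing_eq_lpPairing, map_sub]
  ring

variable {u₀ : L2Space n} {u : ℝ → L2Space n}

/-- The equation tested on the Fourier side. -/
lemma IsFreeSchrodingerSolution.hasDerivAt_pairing_fourier (hu : IsFreeSchrodingerSolution u₀ u)
    {t : ℝ} (ht : 0 < t) (ψ χ : 𝓢(ℝⁿ, ℂ))
    (hχ : ∀ ξ, χ ξ = -((symbolSq ξ : ℂ) * Complex.I * ψ ξ)) :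
    HasDerivAt (fun s => pairing (𝓕 (u s)) (ψ.toLp 2 volume))
      (pairing (𝓕 (u t)) (χ.toLp 2 volume)) t := by
  have h := hu.equation t ht (𝓕 ψ)
  have e : ∀ s, pairing (𝓕 (u s)) (ψ.toLp 2 volume) = (u s : 𝓢'(ℝⁿ, ℂ)) (𝓕 ψ) := fun s => by
    rw [pairing_toLp, ← Lp.fourier_toTemperedDistribution_eq, TemperedDistribution.fourier_apply]
  simp only [e]
  convert h using 1
  -- The Laplacian is the Fourier multiplier `-(2π)²‖ξ‖²`; tested on `𝓕 ψ`, it acts on `ψ` by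
  -- multiplication.
  rw [TemperedDistribution.laplacian_eq_fourierMultiplierCLM, pairing_toLp]
  have hg : (fun x : ℝⁿ => Complex.ofReal (‖x‖ ^ 2)).HasTemperateGrowth := by fun_prop
  have hχ' : χ = Complex.I • (-(2 * Real.pi) ^ 2 : ℝ) •
      SchwartzMap.smulLeftCLM ℂ (fun x : ℝⁿ => Complex.ofReal (‖x‖ ^ 2)) ψ := by
    ext ξ
    simp only [hχ, _root_.smul_apply, SchwartzMap.smulLeftCLM_apply_apply hg, symbolSq,
      smul_eq_mul, Complex.real_smul]
    push_cast
    ring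
  rw [hχ']
  simp only [_root_.smul_apply,
    TemperedDistribution.fourierMultiplierCLM_apply_apply, FourierTransform.fourierInv_fourier_eq]
  rw [← Lp.fourier_toTemperedDistribution_eq, TemperedDistribution.fourier_apply,
    ← TemperedDistribution.fourier_apply, ← TemperedDistribution.fourier_apply, map_smul,
    ← Complex.coe_smul, map_smul, Complex.coe_smul]

/-- A conservation law: the phase on the test function undoes the evolution, since its time
derivative cancels the one given by the equation. -/
lemma IsFreeSchrodingerSolution.pairing_phase_eq (hu : IsFreeSchrodingerSolution u₀ u)
    {t : ℝ} (ht : 0 ≤ t) :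
    pairing (𝓕 (u t)) ((mulSchwartz φ _ hφ hc (contDiff_phase t)).toLp 2 volume) =
      pairing (𝓕 u₀) ((mulSchwartz φ _ hφ hc (contDiff_phase 0)).toLp 2 volume) := by
  have hF : Continuous fun g : L2Space n => (𝓕 g : L2Space n) :=
    (Lp.fourierTransformₗᵢ ℝⁿ ℂ).continuous
  have hv : ContinuousOn (fun s => (𝓕 (u s) : L2Space n)) (Ici 0) :=
    hF.comp_continuousOn hu.continuousOn
  set p : ℝ → L2Space n := fun s =>
    (mulSchwartz φ _ hφ hc (contDiff_phase s)).toLp 2 volume with hp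
  have hpd : ∀ s, HasDerivAt p _ s := fun s => hasDerivAt_phase_toLp hφ hc s
  set N : ℝ → ℂ := fun s => pairing (𝓕 (u s)) (p s) with hN
  have hcont : ContinuousOn N (Ici 0) :=
    continuousOn_pairing hv fun s _ => (hpd s).continuousAt.continuousWithinAt
  have hder : ∀ s, 0 < s → HasDerivAt N 0 s := by
    intro s hs
    have h1 := hu.hasDerivAt_pairing_fourier hs (mulSchwartz φ _ hφ hc (contDiff_phase s))
      (-(mulSchwartz φ _ hφ hc (contDiff_symbol_mul_phase s))) (fun ξ => by
        simp only [_root_.neg_apply, mulSchwartz_apply]; ring)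
    have h5 := hasDerivAt_pairing (hv.continuousAt (Ici_mem_nhds hs)) (hpd s) h1
    convert h5 using 1
    have : (-(mulSchwartz φ _ hφ hc (contDiff_symbol_mul_phase s))).toLp 2 volume =
        -((mulSchwartz φ _ hφ hc (contDiff_symbol_mul_phase s)).toLp 2 volume : L2Space n) :=
      map_neg (SchwartzMap.toLpCLM ℂ (E := ℝⁿ) ℂ 2 volume) _
    rw [this, pairing_eq_lpPairing, pairing_eq_lpPairing, map_neg]
    ring
  have h0 : N t = N 0 := by
    rcases ht.eq_or_lt with rfl | ht
    · rfl
    -- The equation is available for positive times only: `N` is constant on `[r, t]` for `r > 0`,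
    -- and continuity at `0` allows `r → 0`.
    have h1 : Tendsto N (𝓝[>] 0) (𝓝 (N 0)) :=
      (hcont 0 self_mem_Ici).tendsto.mono_left (nhdsWithin_mono _ Ioi_subset_Ici_self)
    have h2 : Tendsto N (𝓝[>] 0) (𝓝 (N t)) := by
      refine tendsto_const_nhds.congr' ?_
      filter_upwards [Ioc_mem_nhdsGT ht] with r hr
      refine constant_of_has_deriv_right_zero (a := r) (b := t)
        (hcont.mono (Icc_subset_Ici_self.trans (Ici_subset_Ici.2 hr.1.le)))
        (fun s hs => (hder s (hr.1.trans_le hs.1)).hasDerivWithinAt) t ⟨hr.2, le_rfl⟩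
    exact tendsto_nhds_unique h2 h1
  simpa only [hN, hp, hu.initial] using h0

/-- The free evolution is multiplication by `exp (-4π² i t |ξ|²)` on the Fourier side. -/
theorem IsFreeSchrodingerSolution.fourier_ae_eq (hu : IsFreeSchrodingerSolution u₀ u)
    {t : ℝ} (ht : 0 ≤ t) :
    (𝓕 (u t) : L2Space n) =ᵐ[volume] fun ξ =>
      Complex.exp (((-t * symbolSq ξ : ℝ) : ℂ) * Complex.I) * (𝓕 u₀ : L2Space n) ξ := by
  have h : ∀ᵐ ξ : ℝⁿ, Complex.exp (((t * symbolSq ξ : ℝ) : ℂ) * Complex.I) *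
      (𝓕 (u t) : L2Space n) ξ = (𝓕 u₀ : L2Space n) ξ := by
    have hm := Lp.memLp (𝓕 (u t) : L2Space n)
    have hm' : MemLp (fun ξ : ℝⁿ => Complex.exp (((t * symbolSq ξ : ℝ) : ℂ) * Complex.I) *
        (𝓕 (u t) : L2Space n) ξ) 2 volume := by
      refine hm.of_le ((contDiff_phase t).continuous.aestronglyMeasurable.mul hm.1) ?_
      refine Eventually.of_forall fun ξ => ?_
      rw [norm_mul, Complex.norm_exp_ofReal_mul_I, one_mul]
    refine ae_eq_of_integral_contDiff_smul_eq (hm'.locallyIntegrable (by norm_num))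
      ((Lp.memLp _).locallyIntegrable (by norm_num)) fun φ hφ hφc => ?_
    have hc : HasCompactSupport (Complex.ofRealCLM ∘ φ) := hφc.comp_left rfl
    have hs : ContDiff ℝ ((⊤ : ℕ∞) : WithTop ℕ∞) (Complex.ofRealCLM ∘ φ) :=
      Complex.ofRealCLM.contDiff.comp hφ
    have := hu.pairing_phase_eq hs hc ht
    rw [pairing_toLp, pairing_toLp, Lp.toTemperedDistribution_apply,
      Lp.toTemperedDistribution_apply] at this
    simp only [mulSchwartz_apply, smul_eq_mul, Function.comp, Complex.ofRealCLM_apply,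
      zero_mul, Complex.ofReal_zero, Complex.exp_zero, one_mul] at this
    simp only [Complex.real_smul]
    rw [← this]
    refine integral_congr_ae (Eventually.of_forall fun ξ => ?_)
    ring
  filter_upwards [h] with ξ hξ
  rw [← hξ, ← mul_assoc, ← Complex.exp_add, ← add_mul, ← Complex.ofReal_add]
  simp

end Propagation

/-! ### Complex Weyl operators acting on Gaussians -/

/-- Finite linear combinations of Gaussians. -/
def gaussComb {n m : ℕ} (K : ℂ) (d : Fin m → ℂ) (w : Fin m → Fin n → ℂ)
    (x : EuclideanSpace ℝ (Fin n)) : ℂ := ∑ j, d j * gauss K (w j) x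

/-- The scalar factor in the action of `exp (a λ·x + c λ·p)` on a Gaussian in the variable
`ξ = p / 2π`. -/
def weylCoeff {n : ℕ} (K : ℂ) (lam : EuclideanSpace ℝ (Fin n)) (a c : ℂ) (w : Fin n → ℂ) : ℂ :=
  Complex.exp (-(Complex.I * a * cdot w lam / (2 * Real.pi)) +
    a ^ 2 * K * (‖lam‖ : ℂ) ^ 2 / (4 * Real.pi ^ 2) - Complex.I * a * c * (‖lam‖ : ℂ) ^ 2 / 2)

/-- The shift of the linear coefficient in the action of `exp (a λ·x + c λ·p)` on a Gaussian in
the variable `ξ = p / 2π`. -/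
def weylShift {n : ℕ} (K : ℂ) (lam : EuclideanSpace ℝ (Fin n)) (a c : ℂ) (w : Fin n → ℂ) :
    Fin n → ℂ :=
  w + (Complex.I * a * K / Real.pi + 2 * Real.pi * c) • toC lam

/-- The action of `exp (a λ·x + c λ·p)` on finite linear combinations of Gaussians in the variable
`ξ = p / 2π`. -/
def weylComb {n m : ℕ} (K : ℂ) (lam : EuclideanSpace ℝ (Fin n)) (a c : ℂ) (d : Fin m → ℂ)
    (w : Fin m → Fin n → ℂ) : EuclideanSpace ℝ (Fin n) → ℂ :=
  gaussComb K (fun j => d j * weylCoeff K lam a c (w j)) (fun j => weylShift K lam a c (w j))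

/-- `‖exp (a λ·x + c λ·p) v‖ ≤ M`, tested against Gaussians. -/
def WeylBound {n : ℕ} (v : EuclideanSpace ℝ (Fin n) → ℂ) (K : ℂ)
    (lam : EuclideanSpace ℝ (Fin n)) (a c : ℂ) (M : ℝ) : Prop :=
  ∀ (m : ℕ) (d : Fin m → ℂ) (w : Fin m → Fin n → ℂ),
    ‖∫ x, v x * weylComb K lam a c d w x‖ ≤ M * (eLpNorm (gaussComb K d w) 2 volume).toReal

section Weyl

variable {n m : ℕ}

lemma cdot_toC_self (v : EuclideanSpace ℝ (Fin n)) : cdot (toC v) v = (‖v‖ : ℂ) ^ 2 := by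
  rw [← inner_eq_cdot, real_inner_self_eq_norm_sq, Complex.ofReal_pow]

lemma cdot_weylShift (K : ℂ) (lam x : EuclideanSpace ℝ (Fin n)) (a c : ℂ) (w : Fin n → ℂ) :
    cdot (weylShift K lam a c w) x =
      cdot w x + (Complex.I * a * K / Real.pi + 2 * Real.pi * c) * cdot (toC lam) x := by
  rw [weylShift, cdot_add_left, cdot_smul_left]

lemma continuous_gaussComb (K : ℂ) (d : Fin m → ℂ) (w : Fin m → Fin n → ℂ) :
    Continuous (gaussComb K d w) := by
  unfold gaussComb; fun_prop

lemma memLp_gaussComb {K : ℂ} (hK : 0 < K.re) (d : Fin m → ℂ) (w : Fin m → Fin n → ℂ) :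
    MemLp (gaussComb K d w) 2 volume :=
  memLp_finsetSum _ fun j _ => (memLp_gauss hK (w j)).const_mul (d j)

lemma integrable_gaussComb {K : ℂ} (hK : 0 < K.re) (d : Fin m → ℂ) (w : Fin m → Fin n → ℂ) :
    Integrable (gaussComb K d w) :=
  integrable_finsetSum _ fun j _ => (integrable_gauss hK (w j)).const_mul (d j)

/-- Baker–Campbell–Hausdorff: the commutator of `λ·x` and `λ·p` is a scalar, so exponentials compose
up to a factor governed by the determinant of `(a, c)` and `(a', c')`. -/
lemma weylCoeff_add (K : ℂ) (lam : EuclideanSpace ℝ (Fin n)) (a c a' c' : ℂ) (w : Fin n → ℂ) :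
    weylCoeff K lam (a + a') (c + c') w =
      Complex.exp (Complex.I / 2 * (a * c' - c * a') * (‖lam‖ : ℂ) ^ 2) *
        (weylCoeff K lam a' c' w * weylCoeff K lam a c (weylShift K lam a' c' w)) := by
  have hpi : (Real.pi : ℂ) ≠ 0 := by exact_mod_cast Real.pi_ne_zero
  simp only [weylCoeff, cdot_weylShift, cdot_toC_self, ← Complex.exp_add]
  congr 1
  field_simp
  ring_nf
  simp only [Complex.I_sq]
  ring

lemma weylShift_add (K : ℂ) (lam : EuclideanSpace ℝ (Fin n)) (a c a' c' : ℂ) (w : Fin n → ℂ) :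
    weylShift K lam (a + a') (c + c') w = weylShift K lam a c (weylShift K lam a' c' w) := by
  simp only [weylShift, add_assoc, ← add_smul]
  congr 2
  ring

lemma weylComb_add (K : ℂ) (lam : EuclideanSpace ℝ (Fin n)) (a c a' c' : ℂ) (d : Fin m → ℂ)
    (w : Fin m → Fin n → ℂ) (x : EuclideanSpace ℝ (Fin n)) :
    weylComb K lam (a + a') (c + c') d w x =
      Complex.exp (Complex.I / 2 * (a * c' - c * a') * (‖lam‖ : ℂ) ^ 2) *
        weylComb K lam a c (fun j => d j * weylCoeff K lam a' c' (w j))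
          (fun j => weylShift K lam a' c' (w j)) x := by
  simp only [weylComb, gaussComb, Finset.mul_sum, weylShift_add]
  refine Finset.sum_congr rfl fun j _ => ?_
  rw [weylCoeff_add]
  ring

lemma norm_add_smul_sq (x v : EuclideanSpace ℝ (Fin n)) (r : ℝ) :
    (‖x + r • v‖ : ℂ) ^ 2 = (‖x‖ : ℂ) ^ 2 + 2 * r * cdot (toC v) x + r ^ 2 * (‖v‖ : ℂ) ^ 2 := by
  have h := norm_add_sq_real x (r • v)
  rw [inner_smul_right, real_inner_comm, norm_smul, mul_pow, Real.norm_eq_abs, sq_abs] at h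
  rw [← inner_eq_cdot]
  have h' := congrArg (fun y : ℝ => (y : ℂ)) h
  push_cast at h'
  rw [h']
  ring

/-- For imaginary parameters the Weyl operators are translations followed by modulations. -/
lemma weylComb_imaginary (K : ℂ) (lam : EuclideanSpace ℝ (Fin n)) (a c : ℝ) (d : Fin m → ℂ)
    (w : Fin m → Fin n → ℂ) (x : EuclideanSpace ℝ (Fin n)) :
    weylComb K lam (a * Complex.I) (c * Complex.I) d w x =
      Complex.exp (((2 * Real.pi * c * inner ℝ lam x + a * c * ‖lam‖ ^ 2 / 2 : ℝ) : ℂ) *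
        Complex.I) * gaussComb K d w (x + (a / (2 * Real.pi)) • lam) := by
  have hpi : (Real.pi : ℂ) ≠ 0 := by exact_mod_cast Real.pi_ne_zero
  simp only [weylComb, gaussComb, Finset.mul_sum]
  refine Finset.sum_congr rfl fun j _ => ?_
  rw [mul_left_comm, mul_assoc]
  congr 1
  simp only [weylCoeff, gauss, ← Complex.exp_add, cdot_weylShift, cdot_add_right,
    cdot_smul_right, norm_add_smul_sq]
  congr 1
  push_cast
  rw [inner_eq_cdot]
  field_simp
  ring_nf
  simp only [Complex.I_sq, show Complex.I ^ 3 = -Complex.I by rw [pow_succ, Complex.I_sq]; ring]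
  ring

lemma eLpNorm_weylComb_imaginary (K : ℂ) (lam : EuclideanSpace ℝ (Fin n)) (a c : ℝ) (d : Fin m → ℂ)
    (w : Fin m → Fin n → ℂ) :
    eLpNorm (weylComb K lam (a * Complex.I) (c * Complex.I) d w) 2 volume =
      eLpNorm (gaussComb K d w) 2 volume := by
  have h1 : eLpNorm (weylComb K lam (a * Complex.I) (c * Complex.I) d w) 2 volume =
      eLpNorm (gaussComb K d w ∘ fun x => x + (a / (2 * Real.pi)) • lam) 2 volume := by
    refine eLpNorm_congr_norm_ae (Filter.Eventually.of_forall fun x => ?_)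
    rw [weylComb_imaginary, norm_mul, Complex.norm_exp_ofReal_mul_I, one_mul]
    rfl
  rw [h1]
  exact eLpNorm_comp_measurePreserving (continuous_gaussComb K d w).aestronglyMeasurable
    (measurePreserving_add_right volume _)

/-- The bound on the line `(a, c) + i ℝ (a', c')`. -/
lemma WeylBound.on_line {v : EuclideanSpace ℝ (Fin n) → ℂ} {K : ℂ}
    {lam : EuclideanSpace ℝ (Fin n)} {a c M : ℝ} (h : WeylBound v K lam a c M) (a' c' : ℝ)
    (d : Fin m → ℂ) (w : Fin m → Fin n → ℂ) :
    ‖∫ x, v x * weylComb K lam (a + a' * Complex.I) (c + c' * Complex.I) d w x‖ ≤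
      Real.exp (-((a * c' - c * a') * ‖lam‖ ^ 2 / 2)) *
        (M * (eLpNorm (gaussComb K d w) 2 volume).toReal) := by
  -- The hypothesis covers all combinations, in particular those already moved by the imaginary Weyl
  -- operator, whose `L²` norms are unchanged.
  have h1 := h m (fun j => d j * weylCoeff K lam (a' * Complex.I) (c' * Complex.I) (w j))
    (fun j => weylShift K lam (a' * Complex.I) (c' * Complex.I) (w j))
  change _ ≤ M * (eLpNorm (weylComb K lam (a' * Complex.I) (c' * Complex.I) d w) 2 volume).toReal
    at h1
  rw [eLpNorm_weylComb_imaginary] at h1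
  simp only [weylComb_add, mul_left_comm (v _)]
  rw [integral_const_mul, norm_mul, Complex.norm_exp]
  refine le_of_eq_of_le ?_ (mul_le_mul_of_nonneg_left h1 (Real.exp_nonneg _))
  congr 2
  have : Complex.I / 2 * ((a : ℂ) * (c' * Complex.I) - c * (a' * Complex.I)) * (‖lam‖ : ℂ) ^ 2 =
      ((-((a * c' - c * a') * ‖lam‖ ^ 2 / 2) : ℝ) : ℂ) := by
    push_cast
    ring_nf
    simp only [Complex.I_sq]
    ring
  rw [this, Complex.ofReal_re]

/-! ### Pairings with Gaussians depend holomorphically on the parameters -/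

lemma norm_cdot_le (w : Fin n → ℂ) (x : EuclideanSpace ℝ (Fin n)) :
    ‖cdot w x‖ ≤ (∑ i, ‖w i‖) * ‖x‖ := by
  rw [cdot, Finset.sum_mul]
  refine (norm_sum_le _ _).trans (Finset.sum_le_sum fun i _ => ?_)
  rw [norm_mul, Complex.norm_real]
  exact mul_le_mul_of_nonneg_left (PiLp.norm_apply_le x i) (norm_nonneg _)

/-- Completing the square absorbs the linear terms at the cost of half of `K.re`. The spare factor
`exp ‖x‖` later dominates the linear factor produced by differentiation in the parameter. -/
lemma norm_gauss_le {K : ℂ} (hK : 0 < K.re) (w : Fin n → ℂ) {R : ℝ}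
    (hR : ∑ i, ‖w i‖ ≤ R) (x : EuclideanSpace ℝ (Fin n)) :
    Real.exp ‖x‖ * ‖gauss K w x‖ ≤
      Real.exp ((R + 1) ^ 2 / (2 * K.re)) * ‖gauss (K.re / 2 : ℝ) 0 x‖ := by
  rw [norm_gauss, norm_gauss, ← Real.exp_add, ← Real.exp_add]
  apply Real.exp_le_exp.2
  have h1 : (cdot w x).re ≤ R * ‖x‖ :=
    (Complex.re_le_norm _).trans ((norm_cdot_le w x).trans
      (mul_le_mul_of_nonneg_right hR (norm_nonneg _)))
  have h2 : cdot (0 : Fin n → ℂ) x = 0 := by simp [cdot]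
  rw [h2, Complex.zero_re, Complex.ofReal_re]
  have h3 : (R + 1) ^ 2 / (2 * K.re) - (R + 1) * ‖x‖ + K.re / 2 * ‖x‖ ^ 2 =
      (R + 1 - K.re * ‖x‖) ^ 2 / (2 * K.re) := by
    field_simp
    ring
  have h4 : 0 ≤ (R + 1 - K.re * ‖x‖) ^ 2 / (2 * K.re) := by positivity
  nlinarith

variable {v : EuclideanSpace ℝ (Fin n) → ℂ}

/-- A linear exponential against half of the Gaussian is at most the exponential of a quadratic in
the size of `w`; this is the source of order two. -/
lemma norm_integral_mul_gauss_le (hv : MemLp v 2 volume) {K : ℂ} (hK : 0 < K.re) :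
    ∃ C : ℝ, 0 ≤ C ∧ ∀ w : Fin n → ℂ, ‖∫ x, v x * gauss K w x‖ ≤
      C * Real.exp ((∑ i, ‖w i‖ + 1) ^ 2 / (2 * K.re)) := by
  have hk : 0 < ((K.re / 2 : ℝ) : ℂ).re := by simpa using hK
  have hi := (integrable_mul_of_memLp_two hv (memLp_gauss hk (0 : Fin n → ℂ))).norm
  refine ⟨∫ x, ‖v x * gauss (K.re / 2 : ℝ) 0 x‖, integral_nonneg fun _ => norm_nonneg _,
    fun w => ?_⟩
  refine (norm_integral_le_of_norm_le (hi.mul_const _)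
    (Filter.Eventually.of_forall fun x => ?_)).trans (le_of_eq (integral_mul_const _ _))
  rw [norm_mul, norm_mul, mul_assoc, mul_comm ‖gauss _ _ _‖ (Real.exp _)]
  refine mul_le_mul_of_nonneg_left (le_trans ?_ (norm_gauss_le hK w le_rfl x)) (norm_nonneg _)
  exact le_mul_of_one_le_left (norm_nonneg _) (Real.one_le_exp (norm_nonneg _))

lemma differentiable_integral_mul_gauss (hv : MemLp v 2 volume) {K : ℂ} (hK : 0 < K.re)
    (w w' : Fin n → ℂ) : Differentiable ℂ fun z : ℂ => ∫ x, v x * gauss K (w + z • w') x := by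
  intro z₀
  have hk : 0 < ((K.re / 2 : ℝ) : ℂ).re := by simpa using hK
  have hi := (integrable_mul_of_memLp_two hv (memLp_gauss hk (0 : Fin n → ℂ))).norm
  set S := ∑ i, ‖w' i‖ with hS
  have hS0 : 0 ≤ S := Finset.sum_nonneg fun _ _ => norm_nonneg _
  set R := ∑ i, ‖w i‖ + (‖z₀‖ + 1) * S with hR
  refine (hasDerivAt_integral_of_dominated_loc_of_deriv_le (μ := volume)
    (F := fun z x => v x * gauss K (w + z • w') x)
    (F' := fun z x => v x * (cdot w' x * gauss K (w + z • w') x))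
    (bound := fun x => ‖v x * gauss (K.re / 2 : ℝ) 0 x‖ *
      (S * Real.exp ((R + 1) ^ 2 / (2 * K.re))))
    (Metric.ball_mem_nhds z₀ one_pos) ?_ ?_ ?_ ?_ (hi.mul_const _) ?_).2.differentiableAt
  · exact Filter.Eventually.of_forall fun z =>
      hv.1.mul (continuous_gauss K _).aestronglyMeasurable
  · exact integrable_mul_of_memLp_two hv (memLp_gauss hK _)
  · exact hv.1.mul ((continuous_cdot w').mul (continuous_gauss K _)).aestronglyMeasurable
  · refine Filter.Eventually.of_forall fun x z hz => ?_
    have hz' : ‖z‖ ≤ ‖z₀‖ + 1 := by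
      have := norm_le_norm_add_norm_sub' z z₀
      rw [mem_ball_iff_norm] at hz
      linarith
    have hsum : ∑ i, ‖(w + z • w') i‖ ≤ R := by
      rw [hR, hS, Finset.mul_sum, ← Finset.sum_add_distrib]
      refine Finset.sum_le_sum fun i _ => (norm_add_le _ _).trans (add_le_add_right ?_ _)
      rw [Pi.smul_apply, norm_smul]
      exact mul_le_mul_of_nonneg_right hz' (norm_nonneg _)
    have h1 := norm_gauss_le hK (w + z • w') hsum x
    have h2 : ‖cdot w' x‖ ≤ S * Real.exp ‖x‖ :=
      (norm_cdot_le w' x).trans (mul_le_mul_of_nonneg_left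
        ((le_add_of_nonneg_right zero_le_one).trans (Real.add_one_le_exp _)) hS0)
    rw [norm_mul, norm_mul, norm_mul, mul_assoc ‖v x‖]
    refine mul_le_mul_of_nonneg_left ?_ (norm_nonneg _)
    calc ‖cdot w' x‖ * ‖gauss K (w + z • w') x‖
        ≤ S * Real.exp ‖x‖ * ‖gauss K (w + z • w') x‖ :=
          mul_le_mul_of_nonneg_right h2 (norm_nonneg _)
      _ = S * (Real.exp ‖x‖ * ‖gauss K (w + z • w') x‖) := by ring
      _ ≤ S * _ := mul_le_mul_of_nonneg_left h1 hS0
      _ = _ := by ring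
  · refine Filter.Eventually.of_forall fun x z _ => ?_
    simp only [gauss, cdot_add_left, cdot_smul_left]
    have h : HasDerivAt (fun z : ℂ => -K * (‖x‖ : ℂ) ^ 2 + (cdot w x + z * cdot w' x))
        (cdot w' x) z := by
      simpa using (((hasDerivAt_id z).mul_const (cdot w' x)).const_add (cdot w x)).const_add
        (-K * (‖x‖ : ℂ) ^ 2)
    have := (h.cexp).const_mul (v x)
    rwa [mul_comm (Complex.exp _)] at this

end Weyl

/-! ### Entire functions of order at most two and the three lines theorem -/

/-- `‖f z‖` grows at most like the exponential of a multiple of `1 + ‖z‖²`. -/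
def QuadExpGrowth (f : ℂ → ℂ) : Prop :=
  ∃ C : ℝ, 0 ≤ C ∧ ∀ z, ‖f z‖ ≤ Real.exp (C * (1 + ‖z‖ ^ 2))

namespace QuadExpGrowth

lemma const (c : ℂ) : QuadExpGrowth fun _ => c := by
  refine ⟨‖c‖, norm_nonneg _, fun z => ?_⟩
  have h1 : ‖c‖ ≤ ‖c‖ * (1 + ‖z‖ ^ 2) :=
    le_mul_of_one_le_right (norm_nonneg _) (by linarith [sq_nonneg ‖z‖])
  linarith [Real.add_one_le_exp (‖c‖ * (1 + ‖z‖ ^ 2))]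

lemma mul {f g : ℂ → ℂ} (hf : QuadExpGrowth f) (hg : QuadExpGrowth g) :
    QuadExpGrowth fun z => f z * g z := by
  obtain ⟨C, hC, hf⟩ := hf
  obtain ⟨D, hD, hg⟩ := hg
  refine ⟨C + D, add_nonneg hC hD, fun z => ?_⟩
  rw [norm_mul, add_mul, Real.exp_add]
  exact mul_le_mul (hf z) (hg z) (norm_nonneg _) (Real.exp_nonneg _)

lemma add {f g : ℂ → ℂ} (hf : QuadExpGrowth f) (hg : QuadExpGrowth g) :
    QuadExpGrowth fun z => f z + g z := by
  obtain ⟨C, hC, hf⟩ := hf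
  obtain ⟨D, hD, hg⟩ := hg
  refine ⟨C + D + 1, by positivity, fun z => (norm_add_le _ _).trans ?_⟩
  set s := 1 + ‖z‖ ^ 2 with hs
  have hs1 : 1 ≤ s := by rw [hs]; linarith [sq_nonneg ‖z‖]
  have h1 : Real.exp (C * s) ≤ Real.exp ((C + D) * s) := Real.exp_le_exp.2 (by nlinarith)
  have h2 : Real.exp (D * s) ≤ Real.exp ((C + D) * s) := Real.exp_le_exp.2 (by nlinarith)
  have h3 : 2 ≤ Real.exp s := by linarith [Real.add_one_le_exp s]
  have h4 : Real.exp ((C + D + 1) * s) = Real.exp ((C + D) * s) * Real.exp s := by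
    rw [← Real.exp_add]; congr 1; ring
  rw [h4]
  nlinarith [hf z, hg z, Real.exp_pos ((C + D) * s)]

lemma sum {ι : Type*} (s : Finset ι) {f : ι → ℂ → ℂ} (hf : ∀ i ∈ s, QuadExpGrowth (f i)) :
    QuadExpGrowth fun z => ∑ i ∈ s, f i z := by
  classical
  induction s using Finset.induction_on with
  | empty => simpa using const 0
  | insert i s hi ih =>
    simp only [Finset.sum_insert hi]
    exact (hf i (Finset.mem_insert_self i s)).add
      (ih fun j hj => hf j (Finset.mem_insert_of_mem hj))

lemma of_norm_le {f : ℂ → ℂ} {A B C : ℝ} (hA : 0 ≤ A) (hC : 0 ≤ C)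
    (h : ∀ z, ‖f z‖ ≤ A * Real.exp (C * (B + ‖z‖) ^ 2)) : QuadExpGrowth f := by
  refine ⟨A + C * (2 * B ^ 2 + 2), by positivity, fun z => (h z).trans ?_⟩
  set s := 1 + ‖z‖ ^ 2 with hs
  have hs1 : 1 ≤ s := by rw [hs]; linarith [sq_nonneg ‖z‖]
  rw [add_mul, Real.exp_add]
  refine mul_le_mul ?_ (Real.exp_le_exp.2 ?_) (Real.exp_nonneg _) (Real.exp_nonneg _)
  · nlinarith [Real.add_one_le_exp (A * s)]
  · rw [mul_assoc]
    refine mul_le_mul_of_nonneg_left ?_ hC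
    nlinarith [sq_nonneg (B - ‖z‖), sq_nonneg B, sq_nonneg ‖z‖,
      mul_nonneg (sq_nonneg B) (sq_nonneg ‖z‖)]

lemma exp_quadratic (p q r : ℂ) :
    QuadExpGrowth fun z => Complex.exp (p + q * z + r * z ^ 2) := by
  refine of_norm_le (A := 1) (B := 1) (C := ‖p‖ + ‖q‖ + ‖r‖) zero_le_one (by positivity)
    fun z => ?_
  rw [one_mul, Complex.norm_exp]
  refine Real.exp_le_exp.2 ((Complex.re_le_norm _).trans ?_)
  refine (norm_add₃_le).trans ?_
  rw [norm_mul, norm_mul, norm_pow]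
  nlinarith [norm_nonneg p, norm_nonneg q, norm_nonneg r, norm_nonneg z,
    mul_nonneg (norm_nonneg p) (norm_nonneg z), mul_nonneg (norm_nonneg q) (norm_nonneg z),
    mul_nonneg (norm_nonneg r) (norm_nonneg z), mul_nonneg (norm_nonneg p) (sq_nonneg ‖z‖),
    mul_nonneg (norm_nonneg q) (sq_nonneg ‖z‖)]

open Filter Asymptotics in
/-- A function of order at most two that is bounded by `N` on the boundary of the strip
`0 ≤ re z ≤ 1` is bounded by `N` in the strip. -/
theorem norm_le_of_boundary {f : ℂ → ℂ} (hf : QuadExpGrowth f) (hd : Differentiable ℂ f) {N : ℝ}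
    (h0 : ∀ z : ℂ, z.re = 0 → ‖f z‖ ≤ N) (h1 : ∀ z : ℂ, z.re = 1 → ‖f z‖ ≤ N) {z : ℂ}
    (hz0 : 0 ≤ z.re) (hz1 : z.re ≤ 1) : ‖f z‖ ≤ N := by
  obtain ⟨C, hC, hf⟩ := hf
  -- A strip of width one allows growth `exp (B exp (c |im z|))` with `c < π`, and `c = 1` suffices.
  -- In the strip `1 + ‖z‖² ≤ 2 + (im z)²`, so `1 + y + y²/2 ≤ exp y` at `y = |im z|` leads to `B =
  -- 4 C`.
  refine PhragmenLindelof.vertical_strip hd.diffContOnCl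
    ⟨1, by rw [sub_zero, div_one]; linarith [Real.pi_gt_three], 4 * C, ?_⟩ h0 h1 hz0 hz1
  refine IsBigO.of_bound 1 (Filter.mem_inf_of_right ?_)
  intro z hz
  have hz : 0 < z.re ∧ z.re < 1 := hz
  rw [mem_ofPred_eq, one_mul, Real.norm_of_nonneg (Real.exp_nonneg _), one_mul]
  refine (hf z).trans (Real.exp_le_exp.2 ?_)
  rw [mul_comm 4 C, mul_assoc]
  refine mul_le_mul_of_nonneg_left ?_ hC
  have h2 : ‖z‖ ^ 2 = z.re ^ 2 + z.im ^ 2 := by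
    rw [Complex.sq_norm, Complex.normSq_apply]; ring
  have h3 := Real.quadratic_le_exp_of_nonneg (abs_nonneg z.im)
  rw [sq_abs] at h3
  have h4 := abs_nonneg z.im
  nlinarith [hz.1, hz.2]

end QuadExpGrowth

/-! ### Log-convexity of Weyl bounds -/

section Interpolation

variable {n m : ℕ} {v : EuclideanSpace ℝ (Fin n) → ℂ}

lemma integral_mul_weylComb (hv : MemLp v 2 volume) {K : ℂ} (hK : 0 < K.re)
    (lam : EuclideanSpace ℝ (Fin n)) (a c : ℂ) (d : Fin m → ℂ) (w : Fin m → Fin n → ℂ) :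
    ∫ x, v x * weylComb K lam a c d w x =
      ∑ j, d j * weylCoeff K lam a c (w j) * ∫ x, v x * gauss K (weylShift K lam a c (w j)) x := by
  simp only [weylComb, gaussComb, Finset.mul_sum]
  rw [integral_finsetSum]
  · refine Finset.sum_congr rfl fun j _ => ?_
    rw [← integral_const_mul]
    exact integral_congr_ae (Filter.Eventually.of_forall fun x => by ring)
  · intro j _
    exact integrable_mul_of_memLp_two hv ((memLp_gauss hK _).const_mul _)

lemma quadExpGrowth_integral_mul_gauss (hv : MemLp v 2 volume) {K : ℂ} (hK : 0 < K.re)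
    (w w' : Fin n → ℂ) : QuadExpGrowth fun z : ℂ => ∫ x, v x * gauss K (w + z • w') x := by
  obtain ⟨A, hA, h⟩ := norm_integral_mul_gauss_le hv hK
  set S := ∑ i, ‖w' i‖ with hS
  set R := ∑ i, ‖w i‖ with hR
  have hS0 : 0 ≤ S := Finset.sum_nonneg fun _ _ => norm_nonneg _
  have hR0 : 0 ≤ R := Finset.sum_nonneg fun _ _ => norm_nonneg _
  refine QuadExpGrowth.of_norm_le (A := A) (B := R + 1) (C := (S + 1) ^ 2 / (2 * K.re)) hA
    (by positivity) fun z => (h _).trans ?_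
  refine mul_le_mul_of_nonneg_left (Real.exp_le_exp.2 ?_) hA
  rw [div_mul_eq_mul_div, ← mul_pow]
  refine div_le_div_of_nonneg_right (pow_le_pow_left₀ (by positivity) ?_ 2) (by positivity)
  have hsum : ∑ i, ‖(w + z • w') i‖ ≤ R + ‖z‖ * S := by
    rw [hR, hS, Finset.mul_sum, ← Finset.sum_add_distrib]
    refine Finset.sum_le_sum fun i _ => (norm_add_le _ _).trans (le_of_eq ?_)
    rw [Pi.smul_apply, norm_smul]
  nlinarith [norm_nonneg z, mul_nonneg hS0 hR0, mul_nonneg hS0 (norm_nonneg z)]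

lemma weylCoeff_affine (K : ℂ) (lam : EuclideanSpace ℝ (Fin n)) (a a' c c' : ℂ)
    (w : Fin n → ℂ) : ∃ p q r : ℂ, ∀ z,
      weylCoeff K lam (a + z * a') (c + z * c') w = Complex.exp (p + q * z + r * z ^ 2) := by
  refine ⟨-(Complex.I * a * cdot w lam / (2 * Real.pi)) +
    a ^ 2 * K * (‖lam‖ : ℂ) ^ 2 / (4 * Real.pi ^ 2) - Complex.I * a * c * (‖lam‖ : ℂ) ^ 2 / 2,
    -(Complex.I * a' * cdot w lam / (2 * Real.pi)) +
    2 * a * a' * K * (‖lam‖ : ℂ) ^ 2 / (4 * Real.pi ^ 2) -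
      Complex.I * (a * c' + a' * c) * (‖lam‖ : ℂ) ^ 2 / 2,
    a' ^ 2 * K * (‖lam‖ : ℂ) ^ 2 / (4 * Real.pi ^ 2) -
      Complex.I * a' * c' * (‖lam‖ : ℂ) ^ 2 / 2, fun z => ?_⟩
  rw [weylCoeff]
  congr 1
  ring

lemma weylShift_affine (K : ℂ) (lam : EuclideanSpace ℝ (Fin n)) (a a' c c' : ℂ)
    (w : Fin n → ℂ) (z : ℂ) : weylShift K lam (a + z * a') (c + z * c') w =
      weylShift K lam a c w + z • weylShift K lam a' c' 0 := by
  simp only [weylShift, zero_add, add_assoc, smul_smul, ← add_smul]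
  congr 2
  ring

/-- Along a complex line the scalar coefficients are exponentials of quadratic polynomials and the
linear coefficients of the Gaussians move affinely; both contributions are entire of order at most
two. -/
lemma differentiable_weylComb_pairing (hv : MemLp v 2 volume) {K : ℂ} (hK : 0 < K.re)
    (lam : EuclideanSpace ℝ (Fin n)) (a a' c c' : ℂ) (d : Fin m → ℂ) (w : Fin m → Fin n → ℂ) :
    Differentiable ℂ (fun z => ∫ x, v x * weylComb K lam (a + z * a') (c + z * c') d w x) ∧
      QuadExpGrowth (fun z => ∫ x, v x * weylComb K lam (a + z * a') (c + z * c') d w x) := by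
  simp only [integral_mul_weylComb hv hK, weylShift_affine]
  constructor
  · refine Differentiable.fun_sum fun j _ => ?_
    obtain ⟨p, q, r, h⟩ := weylCoeff_affine K lam a a' c c' (w j)
    simp only [h]
    refine Differentiable.mul (by fun_prop) (differentiable_integral_mul_gauss hv hK _ _)
  · refine QuadExpGrowth.sum _ fun j _ => ?_
    obtain ⟨p, q, r, h⟩ := weylCoeff_affine K lam a a' c c' (w j)
    simp only [h]
    exact ((QuadExpGrowth.const _).mul (QuadExpGrowth.exp_quadratic p q r)).mul
      (quadExpGrowth_integral_mul_gauss hv hK _ _)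

/-- Log-convexity of `(a, c) ↦ ‖exp (a λ·x + c λ·p) v‖`. -/
theorem WeylBound.interp (hv : MemLp v 2 volume) {K : ℂ} (hK : 0 < K.re)
    {lam : EuclideanSpace ℝ (Fin n)} {a₀ c₀ a₁ c₁ M₀ M₁ : ℝ} (hM₀ : 0 < M₀) (hM₁ : 0 < M₁)
    (h₀ : WeylBound v K lam a₀ c₀ M₀) (h₁ : WeylBound v K lam a₁ c₁ M₁) {θ : ℝ}
    (hθ₀ : 0 ≤ θ) (hθ₁ : θ ≤ 1) {a c : ℝ} (ha : a = θ * a₁ + (1 - θ) * a₀)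
    (hc : c = θ * c₁ + (1 - θ) * c₀) :
    WeylBound v K lam a c (M₁ ^ θ * M₀ ^ (1 - θ)) := by
  intro m d w
  set N := (eLpNorm (gaussComb K d w) 2 volume).toReal
  -- Both endpoints have the same determinant with the direction `(a₁ - a₀, c₁ - c₀)`, so the scalar
  -- in `WeylBound.on_line` equals `exp (δ * z.im)` on both edges of the strip.
  set δ : ℝ := (a₁ * c₀ - a₀ * c₁) * ‖lam‖ ^ 2 / 2 with hδ
  obtain ⟨hd, hg⟩ := differentiable_weylComb_pairing hv hK lam a₀ (a₁ - a₀) c₀ (c₁ - c₀) d w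
  set A : ℂ → ℂ := fun z => ∫ x, v x *
    weylComb K lam (a₀ + z * (a₁ - a₀)) (c₀ + z * (c₁ - c₀)) d w x with hA
  -- The term `iδz` cancels that scalar, and the logarithms normalize the bounds `M₀` and `M₁` on
  -- the two edges to `1`.
  set e : ℂ → ℂ := fun z => Complex.exp (-(Real.log M₀ : ℂ) +
    (Complex.I * δ - Real.log M₁ + Real.log M₀) * z + 0 * z ^ 2) with he
  have hen : ∀ z : ℂ, ‖e z‖ = Real.exp (-(δ * z.im)) *
      Real.exp (-(z.re * Real.log M₁ + (1 - z.re) * Real.log M₀)) := by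
    intro z
    rw [he, Complex.norm_exp, ← Real.exp_add]
    congr 1
    simp
    ring
  have key : ‖e θ * A θ‖ ≤ N := by
    refine QuadExpGrowth.norm_le_of_boundary (f := fun z => e z * A z)
      ((QuadExpGrowth.exp_quadratic _ _ _).mul hg) (Differentiable.mul (by fun_prop) hd)
      (fun z hz => ?_) (fun z hz => ?_) (by simpa using hθ₀) (by simpa using hθ₁)
    · have hz' : z = z.im * Complex.I := by
        apply Complex.ext <;> simp [hz]
      have hb := h₀.on_line (z.im * (a₁ - a₀)) (z.im * (c₁ - c₀)) d w
      have hAz : A z = ∫ x, v x * weylComb K lam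
          (a₀ + ((z.im * (a₁ - a₀) : ℝ) : ℂ) * Complex.I)
          (c₀ + ((z.im * (c₁ - c₀) : ℝ) : ℂ) * Complex.I) d w x := by
        rw [hA]
        simp only
        rw [show (a₀ : ℂ) + z * (a₁ - a₀) = a₀ + ((z.im * (a₁ - a₀) : ℝ) : ℂ) * Complex.I by
            conv_lhs => rw [hz']
            push_cast; ring,
          show (c₀ : ℂ) + z * (c₁ - c₀) = c₀ + ((z.im * (c₁ - c₀) : ℝ) : ℂ) * Complex.I by
            conv_lhs => rw [hz']
            push_cast; ring]
      rw [← hAz] at hb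
      rw [norm_mul, hen, hz]
      simp only [zero_mul, sub_zero, one_mul, zero_add]
      rw [Real.exp_neg (Real.log M₀), Real.exp_log hM₀]
      refine (mul_le_mul_of_nonneg_left hb (by positivity)).trans (le_of_eq ?_)
      have : Real.exp (-((a₀ * (z.im * (c₁ - c₀)) - c₀ * (z.im * (a₁ - a₀))) * ‖lam‖ ^ 2 / 2)) =
          (Real.exp (-(δ * z.im)))⁻¹ := by
        rw [← Real.exp_neg, hδ]; congr 1; ring
      rw [this]
      have := (Real.exp_pos (-(δ * z.im))).ne'
      field_simp
      rfl
    · have hz' : z = 1 + z.im * Complex.I := by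
        apply Complex.ext <;> simp [hz]
      have hb := h₁.on_line (z.im * (a₁ - a₀)) (z.im * (c₁ - c₀)) d w
      have hAz : A z = ∫ x, v x * weylComb K lam
          (a₁ + ((z.im * (a₁ - a₀) : ℝ) : ℂ) * Complex.I)
          (c₁ + ((z.im * (c₁ - c₀) : ℝ) : ℂ) * Complex.I) d w x := by
        rw [hA]
        simp only
        rw [show (a₀ : ℂ) + z * (a₁ - a₀) = a₁ + ((z.im * (a₁ - a₀) : ℝ) : ℂ) * Complex.I by
            conv_lhs => rw [hz']
            push_cast; ring,
          show (c₀ : ℂ) + z * (c₁ - c₀) = c₁ + ((z.im * (c₁ - c₀) : ℝ) : ℂ) * Complex.I by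
            conv_lhs => rw [hz']
            push_cast; ring]
      rw [← hAz] at hb
      rw [norm_mul, hen, hz]
      simp only [zero_mul, sub_self, one_mul, add_zero]
      rw [Real.exp_neg (Real.log M₁), Real.exp_log hM₁]
      refine (mul_le_mul_of_nonneg_left hb (by positivity)).trans (le_of_eq ?_)
      have : Real.exp (-((a₁ * (z.im * (c₁ - c₀)) - c₁ * (z.im * (a₁ - a₀))) * ‖lam‖ ^ 2 / 2)) =
          (Real.exp (-(δ * z.im)))⁻¹ := by
        rw [← Real.exp_neg, hδ]; congr 1; ring
      rw [this]
      have := (Real.exp_pos (-(δ * z.im))).ne'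
      field_simp
      rfl
  have hAθ : A θ = ∫ x, v x * weylComb K lam a c d w x := by
    rw [hA]
    simp only
    rw [show (a₀ : ℂ) + θ * (a₁ - a₀) = a by rw [ha]; push_cast; ring,
      show (c₀ : ℂ) + θ * (c₁ - c₀) = c by rw [hc]; push_cast; ring]
  rw [norm_mul, hen, Complex.ofReal_im, Complex.ofReal_re, mul_zero, neg_zero, Real.exp_zero,
    one_mul, hAθ, Real.exp_neg, inv_mul_le_iff₀ (Real.exp_pos _)] at key
  rwa [Real.rpow_def_of_pos hM₁, Real.rpow_def_of_pos hM₀, ← Real.exp_add,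
    mul_comm (Real.log M₁), mul_comm (Real.log M₀)]

end Interpolation

/-! ### Weighted norms and bounds tested on Gaussians -/

section Weights

variable {n m : ℕ}

lemma re_add_imaginary (L : ℂ) (t : ℝ) :
    (L + 4 * Real.pi ^ 2 * t * Complex.I).re = L.re := by
  have : (4 * Real.pi ^ 2 * t * Complex.I : ℂ) = ((4 * Real.pi ^ 2 * t : ℝ) : ℂ) * Complex.I := by
    push_cast; ring
  rw [this, Complex.add_re, Complex.re_ofReal_mul, Complex.I_re, mul_zero, add_zero]

lemma gauss_add_imaginary (L : ℂ) (t : ℝ) (w : Fin n → ℂ) (x : EuclideanSpace ℝ (Fin n)) :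
    gauss (L + 4 * Real.pi ^ 2 * t * Complex.I) w x =
      Complex.exp (((-t * symbolSq x : ℝ) : ℂ) * Complex.I) * gauss L w x := by
  rw [gauss, gauss, ← Complex.exp_add, symbolSq]
  congr 1
  push_cast
  ring

lemma gaussComb_add_imaginary (L : ℂ) (t : ℝ) (d : Fin m → ℂ) (w : Fin m → Fin n → ℂ)
    (x : EuclideanSpace ℝ (Fin n)) :
    gaussComb (L + 4 * Real.pi ^ 2 * t * Complex.I) d w x =
      Complex.exp (((-t * symbolSq x : ℝ) : ℂ) * Complex.I) * gaussComb L d w x := by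
  simp only [gaussComb, Finset.mul_sum, gauss_add_imaginary]
  exact Finset.sum_congr rfl fun j _ => by ring

/-- In the variable `ξ`, `x` acts as a derivative; conjugation by the free phase adds `2tp` to it,
whence `c = 2ts`. The phase is absorbed in the imaginary part of the Gaussian parameter. -/
lemma weylComb_add_imaginary (L : ℂ) (lam : EuclideanSpace ℝ (Fin n)) (s t : ℝ) (d : Fin m → ℂ)
    (w : Fin m → Fin n → ℂ) (x : EuclideanSpace ℝ (Fin n)) :
    weylComb (L + 4 * Real.pi ^ 2 * t * Complex.I) lam s (2 * t * s : ℝ) d w x =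
      Complex.exp (((-t * symbolSq x : ℝ) : ℂ) * Complex.I) * weylComb L lam s 0 d w x := by
  have hpi : (Real.pi : ℂ) ≠ 0 := by exact_mod_cast Real.pi_ne_zero
  rw [weylComb, gaussComb_add_imaginary, weylComb]
  have h1 : ∀ w : Fin n → ℂ, weylCoeff (L + 4 * Real.pi ^ 2 * t * Complex.I) lam s
      (2 * t * s : ℝ) w = weylCoeff L lam s 0 w := by
    intro w
    rw [weylCoeff, weylCoeff]
    congr 1
    push_cast
    field_simp
    ring
  have h2 : ∀ w : Fin n → ℂ, weylShift (L + 4 * Real.pi ^ 2 * t * Complex.I) lam s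
      (2 * t * s : ℝ) w = weylShift L lam s 0 w := by
    intro w
    rw [weylShift, weylShift]
    congr 2
    push_cast
    field_simp
    ring_nf
    rw [Complex.I_sq]
    ring
  simp only [h1, h2]

/-- The Heisenberg picture: `exp (s λ·x)` at time `t` is `exp (s λ·(x + 2 t p))` at time `0`. -/
lemma weylBound_evolution_iff {v₀ vt : EuclideanSpace ℝ (Fin n) → ℂ} {t : ℝ}
    (h : vt =ᵐ[volume] fun ξ => Complex.exp (((-t * symbolSq ξ : ℝ) : ℂ) * Complex.I) * v₀ ξ)
    (L : ℂ) (lam : EuclideanSpace ℝ (Fin n)) (s M : ℝ) :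
    WeylBound v₀ (L + 4 * Real.pi ^ 2 * t * Complex.I) lam s (2 * t * s : ℝ) M ↔
      WeylBound vt L lam s 0 M := by
  refine forall_congr' fun m => forall_congr' fun d => forall_congr' fun w => ?_
  have h1 : ∫ x, v₀ x * weylComb (L + 4 * Real.pi ^ 2 * t * Complex.I) lam s
      (2 * t * s : ℝ) d w x = ∫ x, vt x * weylComb L lam s 0 d w x := by
    refine integral_congr_ae ?_
    filter_upwards [h] with x hx
    rw [hx, weylComb_add_imaginary]
    ring
  have h2 : eLpNorm (gaussComb (L + 4 * Real.pi ^ 2 * t * Complex.I) d w) 2 volume =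
      eLpNorm (gaussComb L d w) 2 volume := by
    refine eLpNorm_congr_norm_ae (Filter.Eventually.of_forall fun x => ?_)
    rw [gaussComb_add_imaginary, norm_mul, Complex.norm_exp_ofReal_mul_I, one_mul]
  rw [h1, h2]

lemma weylComb_zero_left (K : ℂ) (lam : EuclideanSpace ℝ (Fin n)) (c : ℝ) (d : Fin m → ℂ)
    (w : Fin m → Fin n → ℂ) (x : EuclideanSpace ℝ (Fin n)) :
    weylComb K lam (0 : ℝ) c d w x =
      (Real.exp (2 * Real.pi * c * inner ℝ lam x) : ℂ) * gaussComb K d w x := by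
  simp only [weylComb, gaussComb, Finset.mul_sum]
  refine Finset.sum_congr rfl fun j _ => ?_
  rw [mul_left_comm, mul_assoc]
  congr 1
  simp only [weylCoeff, gauss, Complex.ofReal_exp, ← Complex.exp_add, cdot_weylShift]
  congr 1
  push_cast
  rw [inner_eq_cdot]
  ring

/-- A weighted norm on the Fourier side bounds the pairings with Gaussians. -/
lemma weylBound_of_fourier_weight {v : EuclideanSpace ℝ (Fin n) → ℂ} {K : ℂ} (hK : 0 < K.re)
    {lam : EuclideanSpace ℝ (Fin n)} {c : ℝ}
    (h : MemLp (fun ξ => (Real.exp (2 * Real.pi * c * inner ℝ lam ξ) : ℂ) * v ξ) 2 volume) :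
    WeylBound v K lam (0 : ℝ) c
      (eLpNorm (fun ξ => (Real.exp (2 * Real.pi * c * inner ℝ lam ξ) : ℂ) * v ξ) 2
        volume).toReal := by
  intro m d w
  refine le_of_eq_of_le ?_ (norm_integral_mul_le h (memLp_gaussComb hK d w))
  congr 1
  refine integral_congr_ae (Filter.Eventually.of_forall fun x => ?_)
  simp only [weylComb_zero_left]
  ring

lemma fourier_gaussComb {K : ℂ} (hK : 0 < K.re) (d : Fin m → ℂ) (w : Fin m → Fin n → ℂ)
    (x : EuclideanSpace ℝ (Fin n)) :
    𝓕 (gaussComb K d w) x = ∑ j, d j * 𝓕 (gauss K (w j)) x := by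
  simp only [Real.fourier_eq, gaussComb, Finset.smul_sum]
  rw [integral_finsetSum]
  · refine Finset.sum_congr rfl fun j _ => ?_
    rw [← integral_const_mul]
    exact integral_congr_ae (Filter.Eventually.of_forall fun y => by
      simp only [Circle.smul_def, smul_eq_mul]; ring)
  · intro j _
    exact (Real.fourierIntegral_convergent_iff x).2 ((integrable_gauss hK (w j)).const_mul (d j))

lemma memLp_fourier_gaussComb {K : ℂ} (hK : 0 < K.re) (d : Fin m → ℂ) (w : Fin m → Fin n → ℂ) :
    MemLp (𝓕 (gaussComb K d w)) 2 volume := by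
  have : 𝓕 (gaussComb K d w) = fun x => ∑ j, d j * 𝓕 (gauss K (w j)) x :=
    funext fun x => fourier_gaussComb hK d w x
  rw [this]
  exact memLp_finsetSum _ fun j _ => (memLp_fourier_gauss hK (w j)).const_mul (d j)

/-- With `c = 0` only `λ·x` acts, and a Fourier transform turns it into multiplication. -/
lemma fourier_weylComb {L : ℂ} (hL : 0 < L.re) (lam : EuclideanSpace ℝ (Fin n)) (s : ℝ)
    (d : Fin m → ℂ) (w : Fin m → Fin n → ℂ) (x : EuclideanSpace ℝ (Fin n)) :
    𝓕 (weylComb L lam s 0 d w) x =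
      (Real.exp (s * inner ℝ lam x) : ℂ) * 𝓕 (gaussComb L d w) x := by
  have hpi : (Real.pi : ℂ) ≠ 0 := by exact_mod_cast Real.pi_ne_zero
  have hL0 : L ≠ 0 := fun h => by simp [h] at hL
  rw [weylComb, fourier_gaussComb hL, fourier_gaussComb hL, Finset.mul_sum]
  refine Finset.sum_congr rfl fun j _ => ?_
  rw [mul_left_comm _ (d j), mul_assoc]
  congr 1
  rw [fourier_gauss hL, fourier_gauss hL, mul_left_comm, mul_left_comm (Complex.ofReal _)]
  congr 1
  rw [weylCoeff, Complex.ofReal_exp, ← Complex.exp_add, ← Complex.exp_add]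
  congr 1
  push_cast
  rw [inner_eq_cdot, norm_sq_eq_sum]
  simp only [mul_zero, zero_mul, zero_div, sub_zero, add_zero, weylShift]
  simp only [cdot, toC, Pi.add_apply, Pi.smul_apply, smul_eq_mul, Finset.sum_div,
    Finset.mul_sum, ← Finset.sum_neg_distrib,
    ← Finset.sum_add_distrib]
  refine Finset.sum_congr rfl fun i _ => ?_
  field_simp
  ring_nf
  simp only [Complex.I_sq]
  ring

lemma integral_fourier_mul_weylComb (f : L2Space n) {L : ℂ} (hL : 0 < L.re)
    (lam : EuclideanSpace ℝ (Fin n)) (s : ℝ) (d : Fin m → ℂ) (w : Fin m → Fin n → ℂ) :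
    ∫ x, (𝓕 f : L2Space n) x * weylComb L lam s 0 d w x =
      ∫ x, ((Real.exp (s * inner ℝ lam x) : ℂ) * f x) * 𝓕 (gaussComb L d w) x := by
  rw [integral_fourier_mul f (g := weylComb L lam s 0 d w) (integrable_gaussComb hL _ _)
    (memLp_gaussComb hL _ _) (memLp_fourier_gaussComb hL _ _)]
  refine integral_congr_ae (Filter.Eventually.of_forall fun x => ?_)
  simp only [fourier_weylComb hL]
  ring

/-- A weighted norm in position space bounds the pairings with Gaussians. -/
lemma weylBound_of_weight (f : L2Space n) {L : ℂ} (hL : 0 < L.re)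
    {lam : EuclideanSpace ℝ (Fin n)} {s : ℝ}
    (h : MemLp (fun x => (Real.exp (s * inner ℝ lam x) : ℂ) * f x) 2 volume) :
    WeylBound (𝓕 f : L2Space n) L lam s 0
      (eLpNorm (fun x => (Real.exp (s * inner ℝ lam x) : ℂ) * f x) 2 volume).toReal := by
  intro m d w
  rw [integral_fourier_mul_weylComb f hL, ← eLpNorm_fourier (integrable_gaussComb hL d w)
    (memLp_gaussComb hL d w) (memLp_fourier_gaussComb hL d w)]
  exact norm_integral_mul_le h (memLp_fourier_gaussComb hL d w)

/-! ### Duality: weighted norms recovered from pairings with Gaussians -/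

/-- The modulated Gaussian `exp (-|x|² + i η·x)` as an element of `L²`. -/
def modGauss (η : EuclideanSpace ℝ (Fin n)) : L2Space n :=
  (memLp_gauss (K := 1) (by simp) (Complex.I • toC η)).toLp _

/-- Duality: a function whose pairings with combinations of modulated Gaussians are bounded
by the `L²` norm is square integrable. -/
lemma eLpNorm_le_of_pairing_gauss {H : EuclideanSpace ℝ (Fin n) → ℂ} {M : ℝ} (hM : 0 ≤ M)
    (hH : Integrable fun x => H x * gauss 1 0 x)
    (hb : ∀ (m : ℕ) (d : Fin m → ℂ) (η : Fin m → EuclideanSpace ℝ (Fin n)),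
      ‖∑ j, d j * ∫ x, H x * gauss 1 (Complex.I • toC (η j)) x‖ ≤
        M * ‖∑ j, d j • modGauss (η j)‖) :
    eLpNorm H 2 volume ≤ ENNReal.ofReal M := by
  set Φ : (EuclideanSpace ℝ (Fin n) →₀ ℂ) →ₗ[ℂ] L2Space n :=
    Finsupp.linearCombination ℂ modGauss with hΦ
  set l : (EuclideanSpace ℝ (Fin n) →₀ ℂ) →ₗ[ℂ] ℂ := Finsupp.linearCombination ℂ
    (fun η => ∫ x, H x * gauss 1 (Complex.I • toC η) x) with hl
  have hbound : ∀ c, ‖l c‖ ≤ M * ‖Φ c‖ := by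
    intro c
    have key := hb _ (fun j => c (c.support.equivFin.symm j)) (fun j => c.support.equivFin.symm j)
    have e1 : l c = ∑ j, c (c.support.equivFin.symm j) *
        ∫ x, H x * gauss 1 (Complex.I • toC (c.support.equivFin.symm j : EuclideanSpace ℝ _)) x := by
      rw [hl, Finsupp.linearCombination_apply, Finsupp.sum, ← Finset.sum_coe_sort,
        ← c.support.equivFin.symm.sum_comp]
      rfl
    have e2 : Φ c = ∑ j, c (c.support.equivFin.symm j) •
        modGauss (c.support.equivFin.symm j : EuclideanSpace ℝ _) := by
      rw [hΦ, Finsupp.linearCombination_apply, Finsupp.sum, ← Finset.sum_coe_sort,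
        ← c.support.equivFin.symm.sum_comp]
    rw [e1, e2]
    exact key
  -- A linear section of `Φ` carries `l` to the span of the modulated Gaussians, where the bound
  -- makes it continuous; Hahn–Banach then extends it to `L²` without increasing the norm.
  obtain ⟨σ, hσ⟩ := Φ.rangeRestrict.exists_rightInverse_of_surjective Φ.range_rangeRestrict
  have hσ' : ∀ y : LinearMap.range Φ, Φ (σ y) = y := fun y =>
    congrArg Subtype.val (LinearMap.congr_fun hσ y)
  obtain ⟨g, hg, hgn⟩ := exists_extension_norm_eq (LinearMap.range Φ)
    ((l ∘ₗ σ).mkContinuous M fun y => by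
      refine (hbound _).trans (le_of_eq ?_)
      rw [hσ']; rfl)
  have hgM : ‖g‖ ≤ M := hgn.trans_le (LinearMap.mkContinuous_norm_le _ hM _)
  have hgl : ∀ c, g (Φ c) = l c := by
    intro c
    have h1 := hg ⟨Φ c, c, rfl⟩
    -- The choice of section is immaterial: the bound forces `l` to vanish on the kernel of `Φ`.
    have h2 : l (σ ⟨Φ c, c, rfl⟩) = l c := by
      have := hbound (σ ⟨Φ c, c, rfl⟩ - c)
      rw [map_sub, map_sub, hσ', sub_self, norm_zero, mul_zero] at this
      exact sub_eq_zero.1 (norm_le_zero_iff.1 this)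
    exact h1.trans h2
  -- The Riesz representative is the candidate for the conjugate of `H`.
  set h : L2Space n := (InnerProductSpace.toDual ℂ (L2Space n)).symm g with hh
  have hhn : ‖h‖ ≤ M := by rw [hh, LinearIsometryEquiv.norm_map]; exact hgM
  have hpair : ∀ η, ∫ x, (starRingEnd ℂ) (h x) * gauss 1 (Complex.I • toC η) x =
      ∫ x, H x * gauss 1 (Complex.I • toC η) x := by
    intro η
    have h1 := hgl (Finsupp.single η 1)
    rw [hΦ, hl, Finsupp.linearCombination_single, Finsupp.linearCombination_single, one_smul,
      one_smul, ← InnerProductSpace.toDual_symm_apply, L2.inner_def] at h1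
    rw [← h1]
    refine integral_congr_ae ?_
    filter_upwards [(memLp_gauss (K := 1) (by simp) (Complex.I • toC η)).coeFn_toLp] with x hx
    rw [modGauss, hx, RCLike.inner_apply, mul_comm]
  have hmod : ∀ (η x : EuclideanSpace ℝ (Fin n)), gauss 1 (Complex.I • toC η) x =
      Complex.exp ((inner ℝ η x : ℝ) * Complex.I) * gauss 1 0 x := by
    intro η x
    have h2 : cdot (0 : Fin n → ℂ) x = 0 := by simp [cdot]
    rw [gauss, gauss, ← Complex.exp_add, cdot_smul_left, inner_eq_cdot, h2]
    congr 1
    ring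
  have hh2 : MemLp (fun x => (starRingEnd ℂ) (h x)) 2 volume := (Lp.memLp h).star
  have hi : ∀ η, Integrable fun x =>
      (starRingEnd ℂ) (h x) * gauss 1 (Complex.I • toC η) x := fun η =>
    integrable_mul_of_memLp_two hh2 (memLp_gauss (by simp) _)
  have hiH : ∀ η, Integrable fun x => H x * gauss 1 (Complex.I • toC η) x := by
    intro η
    refine (hH.bdd_mul (c := 1) (f := fun x : EuclideanSpace ℝ (Fin n) =>
      Complex.exp ((inner ℝ η x : ℝ) * Complex.I)) (by fun_prop)
      (Filter.Eventually.of_forall fun x => (Complex.norm_exp_ofReal_mul_I _).le)).congr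
      (Filter.Eventually.of_forall fun x => ?_)
    simp only [hmod]
    ring
  -- The pairings with all modulations of `exp (-|x|²)` are the values of a Fourier transform, so
  -- equality of the pairings makes the transform of this product vanish.
  have hzero : (fun x => (H x - (starRingEnd ℂ) (h x)) * gauss 1 0 x) =ᵐ[volume] 0 := by
    refine ae_eq_zero_of_fourier_eq_zero ?_ fun ξ => ?_
    · refine (hH.sub (integrable_mul_of_memLp_two hh2 (memLp_gauss (K := 1) (by simp) 0))).congr
        (Filter.Eventually.of_forall fun x => ?_)
      simp only [Pi.sub_apply]
      ring
    · rw [Real.fourier_eq', ← sub_eq_zero.2 (hpair (-(2 * Real.pi) • ξ)).symm,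
        ← integral_sub (hiH _) (hi _)]
      refine integral_congr_ae (Filter.Eventually.of_forall fun x => ?_)
      simp only [hmod, smul_eq_mul, inner_smul_left, real_inner_comm x ξ]
      simp only [conj_trivial, neg_mul]
      ring
  have hae : H =ᵐ[volume] fun x => (starRingEnd ℂ) (h x) := by
    filter_upwards [hzero] with x hx
    have h0 : gauss 1 0 x ≠ 0 := Complex.exp_ne_zero _
    exact sub_eq_zero.1 ((mul_eq_zero.1 hx).resolve_right h0)
  have hnorm : eLpNorm H 2 volume = eLpNorm h 2 volume := by
    refine eLpNorm_congr_norm_ae ?_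
    filter_upwards [hae] with x hx
    rw [hx, RCLike.norm_conj]
  rw [hnorm, ← ENNReal.ofReal_toReal (Lp.memLp h).2.ne]
  exact ENNReal.ofReal_le_ofReal hhn

lemma norm_sum_smul_toLp {g : Fin m → EuclideanSpace ℝ (Fin n) → ℂ} (hg : ∀ j, MemLp (g j) 2 volume)
    (d : Fin m → ℂ) : ‖∑ j, d j • (hg j).toLp (g j)‖ =
      (eLpNorm (fun x => ∑ j, d j * g j x) 2 volume).toReal := by
  rw [Lp.norm_def]
  congr 1
  refine eLpNorm_congr_ae ?_
  have h1 : ∀ᵐ x, ∀ j, (d j • (hg j).toLp (g j) : L2Space n) x = d j * g j x := by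
    rw [ae_all_iff]
    intro j
    filter_upwards [Lp.coeFn_smul (d j) ((hg j).toLp (g j)), (hg j).coeFn_toLp] with x h1 h2
    rw [h1, Pi.smul_apply, h2, smul_eq_mul]
  filter_upwards [Lp.coeFn_fun_finsetSum Finset.univ fun j => d j • (hg j).toLp (g j), h1]
    with x h2 h3
  rw [h2]
  exact Finset.sum_congr rfl fun j _ => h3 j

/-- Bounds on the pairings with Gaussians control the weighted norm in position space. -/
lemma eLpNorm_weight_le_of_weylBound (f : L2Space n) {lam : EuclideanSpace ℝ (Fin n)} {s M : ℝ}
    (hM : 0 ≤ M) (h : WeylBound (𝓕 f : L2Space n) ((Real.pi ^ 2 : ℝ) : ℂ) lam s 0 M) :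
    eLpNorm (fun x => (Real.exp (s * inner ℝ lam x) : ℂ) * f x) 2 volume ≤ ENNReal.ofReal M := by
  have hpi : (Real.pi : ℂ) ≠ 0 := by exact_mod_cast Real.pi_ne_zero
  have hL : 0 < ((Real.pi ^ 2 : ℝ) : ℂ).re := by
    rw [Complex.ofReal_re]; positivity
  have h1 : ∀ η x : EuclideanSpace ℝ (Fin n), ((Real.exp (s * inner ℝ lam x) : ℂ) * f x) *
      gauss 1 (Complex.I • toC η) x = f x * gauss 1 ((s : ℂ) • toC lam + Complex.I • toC η) x := by
    intro η x
    rw [gauss, gauss, cdot_add_left, cdot_smul_left (s : ℂ), ← inner_eq_cdot, Complex.ofReal_exp,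
      mul_right_comm, mul_comm _ (f x), ← Complex.exp_add]
    congr 2
    push_cast
    ring
  have hint : ∀ η : EuclideanSpace ℝ (Fin n), Integrable fun x =>
      ((Real.exp (s * inner ℝ lam x) : ℂ) * f x) * gauss 1 (Complex.I • toC η) x := by
    intro η
    simp only [h1]
    exact integrable_mul_of_memLp_two (Lp.memLp f) (memLp_gauss (by simp) _)
  have htoC : Complex.I • toC (0 : EuclideanSpace ℝ (Fin n)) = 0 := by
    ext i; simp [toC]
  refine eLpNorm_le_of_pairing_gauss hM (by simpa only [htoC] using hint 0) fun m d η => ?_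
  -- With parameter `π²`, the Fourier transform of the Gaussian with linear coefficient `-π η` is a
  -- nonzero multiple `C j` of `exp (-|x|² + i η·x)`; dividing by `C j` yields the prescribed
  -- combination.
  set w : Fin m → Fin n → ℂ := fun j => (-(Real.pi : ℂ)) • toC (η j) with hw
  set C : Fin m → ℂ := fun j => (Real.pi / ((Real.pi ^ 2 : ℝ) : ℂ)) ^ (n / 2 : ℂ) *
      Complex.exp ((∑ i, w j i ^ 2) / (4 * ((Real.pi ^ 2 : ℝ) : ℂ))) with hC
  have hC0 : ∀ j, C j ≠ 0 := by
    intro j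
    refine mul_ne_zero (fun h0 => ?_) (Complex.exp_ne_zero _)
    have := (Complex.cpow_eq_zero_iff _ _).1 h0
    have h2 : (Real.pi : ℂ) / ((Real.pi ^ 2 : ℝ) : ℂ) ≠ 0 :=
      div_ne_zero hpi (by push_cast; exact pow_ne_zero 2 hpi)
    exact h2 this.1
  have hF : 𝓕 (gaussComb ((Real.pi ^ 2 : ℝ) : ℂ) (fun j => d j / C j) w) =
      fun x => ∑ j, d j * gauss 1 (Complex.I • toC (η j)) x := by
    funext x
    rw [fourier_gaussComb hL]
    refine Finset.sum_congr rfl fun j _ => ?_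
    rw [fourier_gauss_eq_gauss hL]
    have e1 : (Real.pi : ℂ) ^ 2 / ((Real.pi ^ 2 : ℝ) : ℂ) = 1 := by
      push_cast; field_simp
    have e2 : (-(Real.pi * Complex.I / ((Real.pi ^ 2 : ℝ) : ℂ))) • w j =
        Complex.I • toC (η j) := by
      rw [hw, smul_smul]
      congr 1
      push_cast
      field_simp
    rw [e1, e2, ← mul_assoc]
    congr 1
    exact div_mul_cancel₀ _ (hC0 j)
  have h2 := h m (fun j => d j / C j) w
  rw [integral_fourier_mul_weylComb f hL, ← eLpNorm_fourier (integrable_gaussComb hL _ w)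
    (memLp_gaussComb hL _ w) (memLp_fourier_gaussComb hL _ w), hF] at h2
  unfold modGauss
  rw [norm_sum_smul_toLp]
  refine le_of_eq_of_le ?_ h2
  congr 1
  simp only [Finset.mul_sum]
  rw [integral_finsetSum]
  · refine Finset.sum_congr rfl fun j _ => ?_
    rw [← integral_const_mul]
    exact integral_congr_ae (Filter.Eventually.of_forall fun x => by ring)
  · intro j _
    refine ((hint (η j)).const_mul (d j)).congr (Filter.Eventually.of_forall fun x => ?_)
    simp only
    ring

end Weights

/-! ### From linear to quadratic weights -/

section QuadraticWeights

variable {n : ℕ}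

lemma expWeightedNorm_sq (w : EuclideanSpace ℝ (Fin n) → ℝ) (f : EuclideanSpace ℝ (Fin n) → ℂ) :
    expWeightedNorm w f ^ (2 : ℝ) =
      ∫⁻ x, ENNReal.ofReal (Real.exp (2 * w x)) * ‖f x‖ₑ ^ (2 : ℝ) := by
  rw [expWeightedNorm, eLpNorm_eq_lintegral_rpow_enorm_toReal (by norm_num) (by norm_num)]
  simp only [ENNReal.toReal_ofNat, one_div]
  rw [ENNReal.rpow_inv_rpow (by norm_num)]
  refine lintegral_congr fun x => ?_
  rw [enorm_mul, ENNReal.mul_rpow_of_nonneg _ _ (by norm_num)]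
  congr 1
  rw [← ofReal_norm, Complex.norm_real, Real.norm_of_nonneg (Real.exp_nonneg _),
    ENNReal.ofReal_rpow_of_pos (Real.exp_pos _), ← Real.exp_mul, mul_comm]

/-- The Gaussian superposition of linear exponentials is a quadratic exponential. -/
lemma lintegral_exp_inner (s : ℝ) (x : EuclideanSpace ℝ (Fin n)) :
    ∫⁻ lam : EuclideanSpace ℝ (Fin n), ENNReal.ofReal (Real.exp (-(‖lam‖ ^ 2 / 2))) *
        ENNReal.ofReal (Real.exp (2 * (s * inner ℝ lam x))) =
      ENNReal.ofReal ((2 * Real.pi) ^ ((n : ℝ) / 2)) *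
        ENNReal.ofReal (Real.exp (2 * (s ^ 2 * ‖x‖ ^ 2))) := by
  have hb : 0 < ((1 / 2 : ℝ) : ℂ).re := by simp
  have hi := GaussianFourier.integrable_cexp_neg_mul_sq_norm_add hb (2 * s : ℝ) x
  have hI := GaussianFourier.integral_cexp_neg_mul_sq_norm_add hb (2 * s : ℝ) x
  have e : ∀ lam : EuclideanSpace ℝ (Fin n),
      Complex.exp (-((1 / 2 : ℝ) : ℂ) * (‖lam‖ : ℂ) ^ 2 +
        ((2 * s : ℝ) : ℂ) * ((inner ℝ x lam : ℝ) : ℂ)) =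
      ((Real.exp (-(‖lam‖ ^ 2 / 2)) * Real.exp (2 * (s * inner ℝ lam x)) : ℝ) : ℂ) := by
    intro lam
    rw [← Real.exp_add, Complex.ofReal_exp, real_inner_comm]
    congr 1
    push_cast
    ring
  simp only [e] at hi hI
  have hi' : Integrable fun lam : EuclideanSpace ℝ (Fin n) =>
      Real.exp (-(‖lam‖ ^ 2 / 2)) * Real.exp (2 * (s * inner ℝ lam x)) := by
    simpa only [RCLike.re_eq_complex_re, Complex.ofReal_re] using hi.re
  rw [integral_complex_ofReal] at hI
  have hI' : ∫ lam : EuclideanSpace ℝ (Fin n),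
      Real.exp (-(‖lam‖ ^ 2 / 2)) * Real.exp (2 * (s * inner ℝ lam x)) =
      (2 * Real.pi) ^ ((n : ℝ) / 2) * Real.exp (2 * (s ^ 2 * ‖x‖ ^ 2)) := by
    apply Complex.ofReal_injective
    rw [hI, finrank_euclideanSpace, Fintype.card_fin,
      Complex.ofReal_mul ((2 * Real.pi) ^ ((n : ℝ) / 2)), Complex.ofReal_cpow (by positivity),
      Complex.ofReal_exp]
    congr 1
    · push_cast
      congr 1
      ring
    · congr 1
      push_cast
      ring
  simp only [← ENNReal.ofReal_mul (Real.exp_nonneg _)]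
  rw [← ofReal_integral_eq_lintegral_ofReal hi'
    (Filter.Eventually.of_forall fun _ => by positivity), hI',
    ENNReal.ofReal_mul (by positivity)]

lemma aemeasurable_weight_prod (s : ℝ) {f : EuclideanSpace ℝ (Fin n) → ℂ}
    (hf : AEStronglyMeasurable f volume) :
    AEMeasurable (fun p : EuclideanSpace ℝ (Fin n) × EuclideanSpace ℝ (Fin n) =>
      ENNReal.ofReal (Real.exp (2 * (s * inner ℝ p.1 p.2))) * ‖f p.2‖ₑ ^ (2 : ℝ))
      (volume.prod volume) := by
  refine AEMeasurable.mul (by fun_prop) ((hf.comp_snd).enorm.pow_const _)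

lemma aemeasurable_expWeightedNorm_inner (s : ℝ) {f : EuclideanSpace ℝ (Fin n) → ℂ}
    (hf : AEStronglyMeasurable f volume) :
    AEMeasurable (fun lam : EuclideanSpace ℝ (Fin n) =>
      expWeightedNorm (fun x => s * inner ℝ lam x) f ^ (2 : ℝ)) := by
  simp only [expWeightedNorm_sq]
  exact (aemeasurable_weight_prod s hf).lintegral_prod_right'

/-- By Tonelli the Gaussian average over `λ` is computed inside the integral in `x`. -/
lemma lintegral_expWeightedNorm_inner (s : ℝ) {f : EuclideanSpace ℝ (Fin n) → ℂ}
    (hf : AEStronglyMeasurable f volume) :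
    ∫⁻ lam : EuclideanSpace ℝ (Fin n), ENNReal.ofReal (Real.exp (-(‖lam‖ ^ 2 / 2))) *
        expWeightedNorm (fun x => s * inner ℝ lam x) f ^ (2 : ℝ) =
      ENNReal.ofReal ((2 * Real.pi) ^ ((n : ℝ) / 2)) *
        expWeightedNorm (fun x => s ^ 2 * ‖x‖ ^ 2) f ^ (2 : ℝ) := by
  simp only [expWeightedNorm_sq]
  rw [← lintegral_const_mul' _ _ ENNReal.ofReal_ne_top]
  have h1 : ∀ lam : EuclideanSpace ℝ (Fin n), ENNReal.ofReal (Real.exp (-(‖lam‖ ^ 2 / 2))) *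
      ∫⁻ x, ENNReal.ofReal (Real.exp (2 * (s * inner ℝ lam x))) * ‖f x‖ₑ ^ (2 : ℝ) =
      ∫⁻ x, ENNReal.ofReal (Real.exp (-(‖lam‖ ^ 2 / 2))) *
        (ENNReal.ofReal (Real.exp (2 * (s * inner ℝ lam x))) * ‖f x‖ₑ ^ (2 : ℝ)) := fun lam =>
    (lintegral_const_mul' _ _ ENNReal.ofReal_ne_top).symm
  simp only [h1]
  rw [lintegral_lintegral_swap]
  · refine lintegral_congr_ae ?_
    filter_upwards with x
    rw [← mul_assoc, ← lintegral_exp_inner, ← lintegral_mul_const _ (by fun_prop)]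
    exact lintegral_congr fun lam => (mul_assoc _ _ _).symm
  · exact AEMeasurable.mul (by fun_prop) (aemeasurable_weight_prod s hf)

/-- An interpolation inequality for all linear exponential weights implies the one for the
corresponding quadratic exponential weights. -/
theorem expWeightedNorm_quadratic_of_linear {f g h : EuclideanSpace ℝ (Fin n) → ℂ}
    (hf : AEStronglyMeasurable f volume) (hg : AEStronglyMeasurable g volume)
    (hh : AEStronglyMeasurable h volume) {s₀ s₁ s₂ θ : ℝ} (hθ₀ : 0 ≤ θ) (hθ₁ : θ ≤ 1)
    (H : ∀ lam : EuclideanSpace ℝ (Fin n),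
      expWeightedNorm (fun x => s₀ * inner ℝ lam x) f ≤
        expWeightedNorm (fun x => s₁ * inner ℝ lam x) g ^ θ *
          expWeightedNorm (fun x => s₂ * inner ℝ lam x) h ^ (1 - θ)) :
    expWeightedNorm (fun x => s₀ ^ 2 * ‖x‖ ^ 2) f ≤
      expWeightedNorm (fun x => s₁ ^ 2 * ‖x‖ ^ 2) g ^ θ *
        expWeightedNorm (fun x => s₂ ^ 2 * ‖x‖ ^ 2) h ^ (1 - θ) := by
  have hθ' : 0 ≤ 1 - θ := sub_nonneg.2 hθ₁
  set c : ℝ≥0∞ := ENNReal.ofReal ((2 * Real.pi) ^ ((n : ℝ) / 2)) with hc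
  have hc0 : c ≠ 0 := by
    rw [hc, Ne, ENNReal.ofReal_eq_zero, not_le]; positivity
  have hct : c ≠ ⊤ := ENNReal.ofReal_ne_top
  -- Writing `G` as `G ^ θ * G ^ (1 - θ)` serves twice: for the Gaussian density, shared between the
  -- two factors in Hölder's inequality, and for the constant `c`, which cancels.
  have hsplit : ∀ (G A B : ℝ≥0∞), G ≠ 0 → G ≠ ⊤ →
      G * (A ^ θ * B ^ (1 - θ)) ^ (2 : ℝ) =
        (G * A ^ (2 : ℝ)) ^ θ * (G * B ^ (2 : ℝ)) ^ (1 - θ) := by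
    intro G A B hG0 hGt
    rw [ENNReal.mul_rpow_of_nonneg _ _ hθ₀, ENNReal.mul_rpow_of_nonneg _ _ hθ',
      ENNReal.mul_rpow_of_nonneg _ _ (by norm_num : (0 : ℝ) ≤ 2), mul_mul_mul_comm,
      ← ENNReal.rpow_add _ _ hG0 hGt, add_sub_cancel, ENNReal.rpow_one]
    simp only [← ENNReal.rpow_mul]
    rw [mul_comm θ 2, mul_comm (1 - θ) 2]
  rw [← ENNReal.rpow_le_rpow_iff (z := 2) (by norm_num), ← ENNReal.mul_le_mul_iff_right hc0 hct,
    hsplit _ _ _ hc0 hct, ← lintegral_expWeightedNorm_inner s₀ hf,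
    ← lintegral_expWeightedNorm_inner s₁ hg, ← lintegral_expWeightedNorm_inner s₂ hh]
  refine le_trans ?_ (ENNReal.lintegral_mul_norm_pow_le ?_ ?_ hθ₀ hθ' (by ring))
  · refine lintegral_mono fun lam => ?_
    rw [← hsplit _ _ _ (by simp [Real.exp_pos]) ENNReal.ofReal_ne_top]
    exact mul_le_mul_right (ENNReal.rpow_le_rpow (H lam) (by norm_num)) _
  · exact AEMeasurable.mul (by fun_prop) (aemeasurable_expWeightedNorm_inner s₁ hg)
  · exact AEMeasurable.mul (by fun_prop) (aemeasurable_expWeightedNorm_inner s₂ hh)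

end QuadraticWeights

/-! ### Interpolation of weighted norms along the free evolution -/

section Main

variable {n : ℕ} {u₀ : L2Space n} {u : ℝ → L2Space n}

/-- Because `0 * ∞ = 0`, a vanishing factor makes the right side zero even if the other one is
infinite; hence the assumptions `hA` and `hB`. For a solution they hold because a vanishing weighted
norm forces `u₀ = 0`. -/
lemma ENNReal.le_rpow_mul_rpow_of_toReal {X A B : ℝ≥0∞} {θ : ℝ} (hθ₀ : 0 < θ) (hθ₁ : θ < 1)
    (hA : A = 0 → X = 0) (hB : B = 0 → X = 0)
    (h : A ≠ ⊤ → B ≠ ⊤ → 0 < A.toReal → 0 < B.toReal →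
      X ≤ ENNReal.ofReal (A.toReal ^ θ * B.toReal ^ (1 - θ))) :
    X ≤ A ^ θ * B ^ (1 - θ) := by
  have hθ' : 0 < 1 - θ := sub_pos.2 hθ₁
  by_cases hA0 : A = 0
  · rw [hA hA0]; exact zero_le
  by_cases hB0 : B = 0
  · rw [hB hB0]; exact zero_le
  by_cases hAt : A = ⊤
  · rw [hAt, ENNReal.top_rpow_of_pos hθ₀, ENNReal.top_mul]
    · exact le_top
    · exact fun h0 => hB0 ((ENNReal.rpow_eq_zero_iff_of_pos hθ').1 h0)
  by_cases hBt : B = ⊤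
  · rw [hBt, ENNReal.top_rpow_of_pos hθ', ENNReal.mul_top]
    · exact le_top
    · exact fun h0 => hA0 ((ENNReal.rpow_eq_zero_iff_of_pos hθ₀).1 h0)
  have hAp := ENNReal.toReal_pos hA0 hAt
  have hBp := ENNReal.toReal_pos hB0 hBt
  refine (h hAt hBt hAp hBp).trans (le_of_eq ?_)
  rw [ENNReal.ofReal_mul (by positivity), ← ENNReal.ofReal_rpow_of_pos hAp,
    ← ENNReal.ofReal_rpow_of_pos hBp, ENNReal.ofReal_toReal hAt, ENNReal.ofReal_toReal hBt]

lemma memLp_expWeight {w : EuclideanSpace ℝ (Fin n) → ℝ} (hw : Continuous w) (f : L2Space n)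
    (h : expWeightedNorm w f ≠ ⊤) :
    MemLp (fun x => (Real.exp (w x) : ℂ) * f x) 2 volume :=
  ⟨(by fun_prop : Continuous fun x => (Real.exp (w x) : ℂ)).aestronglyMeasurable.mul
    (Lp.memLp f).1, h.lt_top⟩

lemma eq_zero_of_expWeightedNorm_eq_zero {w : EuclideanSpace ℝ (Fin n) → ℝ} (hw : Continuous w)
    {f : L2Space n} (h : expWeightedNorm w f = 0) : f = 0 := by
  have hm : AEStronglyMeasurable (fun x => (Real.exp (w x) : ℂ) * f x) volume :=
    (by fun_prop : Continuous fun x => (Real.exp (w x) : ℂ)).aestronglyMeasurable.mul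
      (Lp.memLp f).1
  rw [expWeightedNorm, eLpNorm_eq_zero_iff hm (by norm_num)] at h
  rw [Lp.eq_zero_iff_ae_eq_zero]
  filter_upwards [h] with x hx
  exact (mul_eq_zero.1 hx).resolve_left (by exact_mod_cast (Real.exp_pos _).ne')

lemma expWeightedNorm_zero (w : EuclideanSpace ℝ (Fin n) → ℝ) :
    expWeightedNorm w (0 : L2Space n) = 0 := by
  rw [expWeightedNorm, ← eLpNorm_zero (α := EuclideanSpace ℝ (Fin n)) (ε := ℂ) (p := 2)
    (μ := volume)]
  refine eLpNorm_congr_ae ?_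
  filter_upwards [Lp.coeFn_zero ℂ 2 (volume : Measure (EuclideanSpace ℝ (Fin n)))] with x hx
  rw [hx]
  simp

lemma IsFreeSchrodingerSolution.norm_eq (hu : IsFreeSchrodingerSolution u₀ u) {t : ℝ}
    (ht : 0 ≤ t) : ‖u t‖ = ‖u₀‖ := by
  rw [← Lp.norm_fourier_eq, ← Lp.norm_fourier_eq u₀, Lp.norm_def, Lp.norm_def]
  congr 1
  refine eLpNorm_congr_norm_ae ?_
  filter_upwards [hu.fourier_ae_eq ht] with ξ hξ
  rw [hξ, norm_mul, Complex.norm_exp_ofReal_mul_I, one_mul]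

lemma IsFreeSchrodingerSolution.eq_zero_iff (hu : IsFreeSchrodingerSolution u₀ u) {t : ℝ}
    (ht : 0 ≤ t) : u t = 0 ↔ u₀ = 0 := by
  rw [← norm_eq_zero, hu.norm_eq ht, norm_eq_zero]

/-- Undoing the evolution changes only the imaginary part of `K`, so the bound holds for every `K`
with positive real part, and bounds from different times can share one `K`. -/
lemma IsFreeSchrodingerSolution.weylBound (hu : IsFreeSchrodingerSolution u₀ u) {t : ℝ}
    (ht : 0 ≤ t) {K : ℂ} (hK : 0 < K.re) (lam : EuclideanSpace ℝ (Fin n)) (s : ℝ)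
    (h : expWeightedNorm (fun x => s * inner ℝ lam x) (u t) ≠ ⊤) :
    WeylBound (𝓕 u₀ : L2Space n) K lam s (2 * t * s : ℝ)
      (expWeightedNorm (fun x => s * inner ℝ lam x) (u t)).toReal := by
  have hL : K = (K + 4 * Real.pi ^ 2 * (-t : ℝ) * Complex.I) +
      4 * Real.pi ^ 2 * t * Complex.I := by push_cast; ring
  have hL' : 0 < (K + 4 * Real.pi ^ 2 * (-t : ℝ) * Complex.I).re := by
    rwa [re_add_imaginary]
  rw [hL, weylBound_evolution_iff (hu.fourier_ae_eq ht)]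
  exact weylBound_of_weight (u t) hL' (memLp_expWeight (by fun_prop) _ h)

lemma IsFreeSchrodingerSolution.expWeightedNorm_le (hu : IsFreeSchrodingerSolution u₀ u) {t : ℝ}
    (ht : 0 ≤ t) {lam : EuclideanSpace ℝ (Fin n)} {s M : ℝ} (hM : 0 ≤ M)
    (h : WeylBound (𝓕 u₀ : L2Space n)
      (((Real.pi ^ 2 : ℝ) : ℂ) + 4 * Real.pi ^ 2 * t * Complex.I) lam s (2 * t * s : ℝ) M) :
    expWeightedNorm (fun x => s * inner ℝ lam x) (u t) ≤ ENNReal.ofReal M :=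
  eLpNorm_weight_le_of_weylBound (u t) hM
    ((weylBound_evolution_iff (hu.fourier_ae_eq ht) _ lam s M).1 h)

lemma re_pi_sq_add_pos (t : ℝ) :
    0 < (((Real.pi ^ 2 : ℝ) : ℂ) + 4 * Real.pi ^ 2 * t * Complex.I).re := by
  rw [re_add_imaginary, Complex.ofReal_re]
  positivity

/-- Interpolation between two times with linear exponential weights. -/
theorem IsFreeSchrodingerSolution.interp_time (hu : IsFreeSchrodingerSolution u₀ u)
    (lam : EuclideanSpace ℝ (Fin n)) {T t s₀ s sT θ : ℝ} (hT : 0 ≤ T) (ht : 0 ≤ t)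
    (hθ₀ : 0 < θ) (hθ₁ : θ < 1) (hs : s = θ * s₀ + (1 - θ) * sT)
    (hts : t * s = (1 - θ) * (T * sT)) :
    expWeightedNorm (fun x => s * inner ℝ lam x) (u t) ≤
      expWeightedNorm (fun x => s₀ * inner ℝ lam x) u₀ ^ θ *
        expWeightedNorm (fun x => sT * inner ℝ lam x) (u T) ^ (1 - θ) := by
  refine ENNReal.le_rpow_mul_rpow_of_toReal hθ₀ hθ₁ (fun h => ?_) (fun h => ?_)
    fun hA hB hA0 hB0 => ?_
  · rw [(hu.eq_zero_iff ht).2 (eq_zero_of_expWeightedNorm_eq_zero (by fun_prop) h)]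
    exact expWeightedNorm_zero _
  · have := (hu.eq_zero_iff hT).1 (eq_zero_of_expWeightedNorm_eq_zero (by fun_prop) h)
    rw [(hu.eq_zero_iff ht).2 this]
    exact expWeightedNorm_zero _
  · rw [← hu.initial] at hA hA0 ⊢
    refine hu.expWeightedNorm_le ht (by positivity) ?_
    rw [hu.initial]
    -- The common `K` is the one that the conclusion at time `t` requires.
    have h1 := hu.weylBound le_rfl (re_pi_sq_add_pos t) lam s₀ hA
    have h0 := hu.weylBound hT (re_pi_sq_add_pos t) lam sT hB
    rw [hu.initial] at h1 hA0
    refine WeylBound.interp (Lp.memLp _) (re_pi_sq_add_pos t) hB0 hA0 h0 h1 hθ₀.le hθ₁.le hs ?_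
    linear_combination 2 * hts

/-- Weighted norms of the angular Fourier transform in terms of Mathlib's normalization. -/
lemma expWeightedNorm_angularFourier (w : EuclideanSpace ℝ (Fin n) → ℝ) (f : L2Space n) :
    expWeightedNorm w (angularFourier f) =
      expWeightedNorm (fun ξ => w ((2 * Real.pi) • ξ)) (𝓕 f : L2Space n) := by
  have hpi : (2 * Real.pi) ≠ 0 := by positivity
  have hr : (2 * Real.pi)⁻¹ ≠ 0 := inv_ne_zero hpi
  set g : EuclideanSpace ℝ (Fin n) → ℂ := fun ξ =>
    (Real.exp (w ((2 * Real.pi) • ξ)) : ℂ) * (𝓕 f : L2Space n) ξ with hg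
  set C : ℂ := (((2 * Real.pi) ^ (-(n : ℝ) / 2) : ℝ) : ℂ) with hC
  have h1 : (fun ξ => (Real.exp (w ξ) : ℂ) * angularFourier f ξ) =
      C • (g ∘ fun ξ => (2 * Real.pi)⁻¹ • ξ) := by
    funext ξ
    simp only [angularFourier, hg, Pi.smul_apply, Function.comp, smul_smul,
      mul_inv_cancel₀ hpi, one_smul, smul_eq_mul]
    ring
  have h2 : eLpNorm (g ∘ fun ξ => (2 * Real.pi)⁻¹ • ξ) 2 volume =
      eLpNorm g 2 (Measure.map (fun ξ => (2 * Real.pi)⁻¹ • ξ) volume) :=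
    ((Homeomorph.smulOfNeZero (2 * Real.pi)⁻¹ hr).measurableEmbedding.eLpNorm_map_measure).symm
  rw [expWeightedNorm, h1, eLpNorm_const_smul, h2, Measure.map_addHaar_smul _ hr,
    eLpNorm_smul_measure_of_ne_top (by norm_num), finrank_euclideanSpace, Fintype.card_fin,
    smul_eq_mul, ← mul_assoc, expWeightedNorm]
  -- The normalization `(2π)^(-n/2)` cancels the square root of the Jacobian of the dilation.
  have h3 : ‖C‖ₑ * ENNReal.ofReal |(((2 * Real.pi)⁻¹) ^ n)⁻¹| ^ (1 / (2 : ℝ≥0∞)).toReal = 1 := by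
    rw [← ofReal_norm, hC, Complex.norm_real, Real.norm_of_nonneg (by positivity), inv_pow,
      inv_inv, abs_of_pos (by positivity), ENNReal.ofReal_rpow_of_pos (by positivity),
      ← ENNReal.ofReal_mul (by positivity), ← Real.rpow_natCast, ← Real.rpow_mul (by positivity),
      ← Real.rpow_add (by positivity)]
    rw [show -(n : ℝ) / 2 + n * (1 / (2 : ℝ≥0∞)).toReal = 0 by simp; ring, Real.rpow_zero,
      ENNReal.ofReal_one]
  rw [h3, one_mul]

/-- Interpolation between the initial datum and its Fourier transform with linear exponential
weights. -/
theorem IsFreeSchrodingerSolution.interp_fourier (hu : IsFreeSchrodingerSolution u₀ u)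
    (lam : EuclideanSpace ℝ (Fin n)) {t s₀ s c θ : ℝ} (ht : 0 ≤ t)
    (hθ₀ : 0 < θ) (hθ₁ : θ < 1) (hs : s = θ * s₀) (hts : 2 * t * s = (1 - θ) * c) :
    expWeightedNorm (fun x => s * inner ℝ lam x) (u t) ≤
      expWeightedNorm (fun x => s₀ * inner ℝ lam x) u₀ ^ θ *
        expWeightedNorm (fun ξ => c * inner ℝ lam ξ) (angularFourier u₀) ^ (1 - θ) := by
  have hF : expWeightedNorm (fun ξ => c * inner ℝ lam ξ) (angularFourier u₀) =
      expWeightedNorm (fun ξ => 2 * Real.pi * c * inner ℝ lam ξ) (𝓕 u₀ : L2Space n) := by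
    rw [expWeightedNorm_angularFourier]
    congr 1
    funext ξ
    rw [inner_smul_right]
    ring
  rw [hF]
  refine ENNReal.le_rpow_mul_rpow_of_toReal hθ₀ hθ₁ (fun h => ?_) (fun h => ?_)
    fun hA hB hA0 hB0 => ?_
  · rw [(hu.eq_zero_iff ht).2 (eq_zero_of_expWeightedNorm_eq_zero (by fun_prop) h)]
    exact expWeightedNorm_zero _
  · have h0 := eq_zero_of_expWeightedNorm_eq_zero (by fun_prop) h
    have : u₀ = 0 := by
      rw [← norm_eq_zero, ← Lp.norm_fourier_eq, h0, norm_zero]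
    rw [(hu.eq_zero_iff ht).2 this]
    exact expWeightedNorm_zero _
  · rw [← hu.initial] at hA hA0
    have h1 := hu.weylBound le_rfl (re_pi_sq_add_pos t) lam s₀ hA
    rw [hu.initial] at h1 hA0
    refine hu.expWeightedNorm_le ht (by positivity) ?_
    have h0 := weylBound_of_fourier_weight (re_pi_sq_add_pos t)
      (memLp_expWeight (by fun_prop) _ hB)
    refine WeylBound.interp (Lp.memLp _) (re_pi_sq_add_pos t) hB0 hA0 h0 h1 hθ₀.le hθ₁.le ?_ ?_
    · linear_combination hs
    · linear_combination hts

/-! ### The exponents `θ` and `μ`, and the linear estimates -/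

lemma thetaExponent_mem {α β T t : ℝ} (hα : 0 < α) (hβ : 0 < β) (hT : 0 < T) (ht : 0 ≤ t)
    (htT : t ≤ T) : 0 ≤ thetaExponent α β T t ∧ thetaExponent α β T t ≤ 1 := by
  unfold thetaExponent
  have h1 : 0 ≤ T - t := sub_nonneg.2 htT
  refine ⟨by positivity, ?_⟩
  rw [div_le_one (by positivity)]
  nlinarith [mul_nonneg hα.le ht, mul_nonneg hβ.le ht, mul_nonneg hT.le (mul_nonneg hα.le ht)]

lemma muExponent_mem {α β t : ℝ} (hα : 0 < α) (hβ : 0 < β) (ht : 0 ≤ t) :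
    0 ≤ muExponent α β t ∧ muExponent α β t ≤ 1 := by
  unfold muExponent
  refine ⟨by positivity, ?_⟩
  rw [div_le_one (by positivity)]
  nlinarith [mul_nonneg hα.le ht]

/-- The points `(1/(αt + β), 2t/(αt + β))` are collinear, and `θ`, `1 - θ = t(αT + β)/(T(αt + β))`
are the barycentric coordinates of the one at time `t` relative to times `0` and `T`. -/
theorem IsFreeSchrodingerSolution.linear_time (hu : IsFreeSchrodingerSolution u₀ u) {α β T t : ℝ}
    (hα : 0 < α) (hβ : 0 < β) (hT : 0 < T) (ht : 0 ≤ t) (htT : t ≤ T)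
    (lam : EuclideanSpace ℝ (Fin n)) :
    expWeightedNorm (fun x => (α * t + β)⁻¹ * inner ℝ lam x) (u t) ≤
      expWeightedNorm (fun x => β⁻¹ * inner ℝ lam x) u₀ ^ thetaExponent α β T t *
        expWeightedNorm (fun x => (α * T + β)⁻¹ * inner ℝ lam x) (u T) ^
          (1 - thetaExponent α β T t) := by
  -- At `t = 0` and `t = T` the exponents are `0` and `1` and the two sides agree; interpolation
  -- needs `0 < θ < 1`.
  rcases ht.eq_or_lt with rfl | ht0
  · have : thetaExponent α β T 0 = 1 := by
      unfold thetaExponent; rw [mul_zero, zero_add, sub_zero]; field_simp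
    rw [this, sub_self, ENNReal.rpow_one, ENNReal.rpow_zero, mul_one, hu.initial, mul_zero,
      zero_add]
  rcases htT.eq_or_lt with rfl | htT0
  · have : thetaExponent α β t t = 0 := by unfold thetaExponent; simp
    rw [this, sub_zero, ENNReal.rpow_one, ENNReal.rpow_zero, one_mul]
  have h1 : 0 < T - t := sub_pos.2 htT0
  have hd : 0 < α * t + β := by positivity
  have hD : 0 < α * T + β := by positivity
  refine hu.interp_time lam hT.le ht ?_ ?_ ?_ ?_
  · unfold thetaExponent; positivity
  · unfold thetaExponent
    rw [div_lt_one (by positivity)]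
    nlinarith [mul_pos hβ ht0, mul_pos hT (mul_pos hα ht0)]
  · unfold thetaExponent
    field_simp
    ring
  · unfold thetaExponent
    field_simp
    ring

/-- The second endpoint is `(0, 2/α)`, the limit of the collinear points as time tends to infinity.
-/
theorem IsFreeSchrodingerSolution.linear_fourier (hu : IsFreeSchrodingerSolution u₀ u)
    {α β t : ℝ} (hα : 0 < α) (hβ : 0 < β) (ht : 0 ≤ t) (lam : EuclideanSpace ℝ (Fin n)) :
    expWeightedNorm (fun x => (α * t + β)⁻¹ * inner ℝ lam x) (u t) ≤
      expWeightedNorm (fun x => β⁻¹ * inner ℝ lam x) u₀ ^ muExponent α β t *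
        expWeightedNorm (fun ξ => 2 / α * inner ℝ lam ξ) (angularFourier u₀) ^
          (1 - muExponent α β t) := by
  rcases ht.eq_or_lt with rfl | ht0
  · have : muExponent α β 0 = 1 := by
      unfold muExponent; rw [mul_zero, zero_add]; field_simp
    rw [this, sub_self, ENNReal.rpow_one, ENNReal.rpow_zero, mul_one, hu.initial, mul_zero,
      zero_add]
  have hd : 0 < α * t + β := by positivity
  refine hu.interp_fourier lam ht ?_ ?_ ?_ ?_
  · unfold muExponent; positivity
  · unfold muExponent
    rw [div_lt_one (by positivity)]
    linarith [mul_pos hα ht0]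
  · unfold muExponent
    field_simp
  · unfold muExponent
    field_simp
    ring

lemma aestronglyMeasurable_angularFourier (f : L2Space n) :
    AEStronglyMeasurable (angularFourier f) volume := by
  have hr : (2 * Real.pi)⁻¹ ≠ 0 := by positivity
  have h : Measure.QuasiMeasurePreserving
      (fun ξ : EuclideanSpace ℝ (Fin n) => (2 * Real.pi)⁻¹ • ξ) volume volume := by
    refine ⟨by fun_prop, ?_⟩
    rw [Measure.map_addHaar_smul _ hr]
    exact Measure.smul_absolutelyContinuous
  exact aestronglyMeasurable_const.mul
    ((Lp.memLp (𝓕 f : L2Space n)).1.comp_quasiMeasurePreserving h)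

end Main

end

/-- The norms take values in `[0, ∞]`, so each inequality says in particular that its left-hand
side is finite whenever its right-hand side is. -/
theorem theorem1p2 (n : ℕ) (α β : ℝ) (hα : 0 < α) (hβ : 0 < β)
    (u₀ : L2Space n) (u : ℝ → L2Space n) (hu : IsFreeSchrodingerSolution u₀ u) :
    (∀ (lam : EuclideanSpace ℝ (Fin n)) (T : ℝ), 0 < T → ∀ t : ℝ, 0 ≤ t → t ≤ T →
      expWeightedNorm (fun x => inner ℝ lam x / (α * t + β)) (u t) ≤
        expWeightedNorm (fun x => inner ℝ lam x / β) u₀ ^ thetaExponent α β T t *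
          expWeightedNorm (fun x => inner ℝ lam x / (α * T + β)) (u T) ^
            (1 - thetaExponent α β T t)) ∧
    (∀ (lam : EuclideanSpace ℝ (Fin n)) (t : ℝ), 0 ≤ t →
      expWeightedNorm (fun x => inner ℝ lam x / (α * t + β)) (u t) ≤
        expWeightedNorm (fun x => inner ℝ lam x / β) u₀ ^ muExponent α β t *
          expWeightedNorm (fun ξ => 2 * inner ℝ lam ξ / α) (angularFourier u₀) ^
            (1 - muExponent α β t)) ∧
    (∀ T : ℝ, 0 < T → ∀ t : ℝ, 0 ≤ t → t ≤ T →
      expWeightedNorm (fun x => ‖x‖ ^ 2 / (α * t + β) ^ 2) (u t) ≤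
        expWeightedNorm (fun x => ‖x‖ ^ 2 / β ^ 2) u₀ ^ thetaExponent α β T t *
          expWeightedNorm (fun x => ‖x‖ ^ 2 / (α * T + β) ^ 2) (u T) ^
            (1 - thetaExponent α β T t)) ∧
    (∀ t : ℝ, 0 ≤ t →
      expWeightedNorm (fun x => ‖x‖ ^ 2 / (α * t + β) ^ 2) (u t) ≤
        expWeightedNorm (fun x => ‖x‖ ^ 2 / β ^ 2) u₀ ^ muExponent α β t *
          expWeightedNorm (fun ξ => 4 * ‖ξ‖ ^ 2 / α ^ 2) (angularFourier u₀) ^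
            (1 - muExponent α β t)) := by
  have hdiv : ∀ a b : ℝ, a / b = b⁻¹ * a := fun a b => by rw [div_eq_mul_inv, mul_comm]
  have hdiv' : ∀ a b : ℝ, a ^ 2 / b ^ 2 = b⁻¹ ^ 2 * a ^ 2 := fun a b => by
    rw [hdiv, inv_pow]
  have h2 : ∀ a : ℝ, 2 * a / α = 2 / α * a := fun a => by ring
  have h4 : ∀ a : ℝ, 4 * a ^ 2 / α ^ 2 = (2 / α) ^ 2 * a ^ 2 := fun a => by ring
  refine ⟨fun lam T hT t ht htT => ?_, fun lam t ht => ?_, fun T hT t ht htT => ?_,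
    fun t ht => ?_⟩
  · simp only [hdiv]
    exact hu.linear_time hα hβ hT ht htT lam
  · simp only [h2]
    simp only [hdiv (inner ℝ lam _)]
    exact hu.linear_fourier hα hβ ht lam
  · simp only [hdiv']
    obtain ⟨h0, h1⟩ := thetaExponent_mem hα hβ hT ht htT
    exact expWeightedNorm_quadratic_of_linear (Lp.memLp _).1 (Lp.memLp _).1 (Lp.memLp _).1 h0 h1
      (hu.linear_time hα hβ hT ht htT)
  · simp only [h4, hdiv']
    obtain ⟨h0, h1⟩ := muExponent_mem hα hβ ht
    exact expWeightedNorm_quadratic_of_linear (Lp.memLp _).1 (Lp.memLp _).1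
      (aestronglyMeasurable_angularFourier u₀) h0 h1 (hu.linear_fourier hα hβ ht)
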